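/- Let $(\Omega,\mathcal F,\mathbb P)$ be a probability space with a filtration $(\mathcal F_i)_{i\ge 0}$, and let $(X_i)_{i\ge 0}$ be a supermartingale difference sequence: each $X_i$ is integrable and $\mathcal F_i$-measurable, and $\mathbb E[X_i\mid\mathcal F_{i-1}]\le 0$ almost surely for $i\ge 1$. Suppose that $X_0=0$ and $X_i\le 1$ almost surely for all $i$. For $i\ge1$ let $\sigma_i^2=\mathbb E[X_i^2\mid\mathcal F_{i-1}]\in[0,\infty]$. Let $x\in\mathbb R$ and $0<v<\infty$, and for $k\ge 1$ put $$\mathcal E_k=\Big\{\sum_{i=1}^k X_i\ge x\ \text{ and }\ \sum_{i=1}^k\sigma_i^2\le v^2\Big\}.$$ Write $u_+=\max\{u,0\}$. Then for every integer $n\ge 1$, $$\mathbb P\Big(\bigcup_{k=1}^n\mathcal E_k\Big)\ \le\ \inf_{\lambda\ge 0}\mathbb E\Big[\Big(1+\frac{\lambda}{2}\Big(\sum_{i=1}^n G_i-x\Big)\Big)_+^2\Big]\ \le\ \inf_{\lambda\ge 0}\mathbb E\Big[\Big(1+\frac{\lambda}{2}\big(\widetilde\Pi_{v^2}-x\big)\Big)_+^2\Big],$$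 where $G_1,\dots,G_n$ are independent and identically distributed with $$\mathbb P(G_i=-v^2/n)=\frac{1}{1+v^2/n},\qquad \mathbb P(G_i=1)=\frac{v^2/n}{1+v^2/n},$$ and $\widetilde\Pi_{v^2}=N-v^2$ with $N$ a Poisson random variable of mean $v^2$. Moreover, $$\mathbb P\Big(\bigcup_{k\ge 1}\mathcal E_k\Big)\ \le\ \inf_{\lambda\ge 0}\mathbb E\Big[\Big(1+\frac{\lambda}{2}\big(\widetilde\Pi_{v^2}-x\big)\Big)_+^2\Big]\ \le\ \frac{e^2}{2}\,\mathbb P^{\circ}\big(\widetilde\Pi_{v^2}\ge x\big),$$ where $y\mapsto\mathbb P^{\circ}(\widetilde\Pi_{v^2}\ge y)$ is the least log-concave function on $\mathbb R$ that is greater than or equal to $y\mapsto\mathbb P(\widetilde\Pi_{v^2}\ge y)$ at every $y\in\mathbb R$. -/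

import Mathlib

open MeasureTheory ProbabilityTheory
open scoped ENNReal NNReal

namespace Freedman

variable {Ω : Type*} {m0 : MeasurableSpace Ω}

/-- `(X_i, ℱ_i)_{i ≥ 0}` is a supermartingale difference sequence: `X_i` is integrable and
`ℱ_i`-measurable, and `E[X_{i+1} | ℱ_i] ≤ 0` almost surely for every `i ≥ 0`. -/
structure IsSupermartingaleDifference (X : ℕ → Ω → ℝ) (ℱ : Filtration ℕ m0) (μ : Measure Ω) :
    Prop where
  adapted : StronglyAdapted ℱ X
  integrable : ∀ i, Integrable (X i) μ
  condExp_nonpos : ∀ i, μ[X (i + 1) | ℱ i] ≤ᵐ[μ] 0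

/-- `σ_i² = E[X_i² | ℱ_{i-1}]`, used only for `i ≥ 1`. It is the conditional expectation of a
nonnegative random variable, with values in `[0, ∞]`, so that it makes sense without
square integrability of `X_i`. -/
noncomputable def condSq (X : ℕ → Ω → ℝ) (ℱ : Filtration ℕ m0) (μ : Measure Ω) (i : ℕ) :
    Ω → ℝ≥0∞ :=
  condLExp (ℱ (i - 1)) μ (fun ω => ENNReal.ofReal (X i ω ^ 2))

/-- The event `∑_{i=1}^k X_i ≥ x` and `∑_{i=1}^k σ_i² ≤ v²`. -/
def event (X : ℕ → Ω → ℝ) (ℱ : Filtration ℕ m0) (μ : Measure Ω) (x v : ℝ) (k : ℕ) : Set Ω :=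
  {ω | x ≤ ∑ i ∈ Finset.Icc 1 k, X i ω ∧
    ∑ i ∈ Finset.Icc 1 k, condSq X ℱ μ i ω ≤ ENNReal.ofReal (v ^ 2)}

/-- `inf_{t ≥ 0} E[(1 + (t/2) (S - x))_+²]` for a random variable `S` on `(Ω, μ)`. -/
noncomputable def bentkusBound (μ : Measure Ω) (S : Ω → ℝ) (x : ℝ) : ℝ :=
  ⨅ t : ℝ≥0, ∫ ω, (max (1 + (t : ℝ) / 2 * (S ω - x)) 0) ^ 2 ∂μ

/-- The mean zero law on `{-s, 1}`: mass `1 / (1 + s)` at `-s` and mass `s / (1 + s)` at `1`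
(for `s ≥ 0`). -/
noncomputable def twoPoint (s : ℝ) : Measure ℝ :=
  ENNReal.ofReal (1 / (1 + s)) • Measure.dirac (-s) +
    ENNReal.ofReal (s / (1 + s)) • Measure.dirac 1

theorem isProbabilityMeasure_twoPoint {s : ℝ} (hs : 0 ≤ s) : IsProbabilityMeasure (twoPoint s) := by
  constructor
  have h1 : (0 : ℝ) ≤ 1 / (1 + s) := by positivity
  have h2 : (0 : ℝ) ≤ s / (1 + s) := by positivity
  have h3 : 1 / (1 + s) + s / (1 + s) = 1 := by field_simp
  simp only [twoPoint, Measure.coe_add, Measure.coe_smul, Pi.add_apply, Pi.smul_apply,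
    measure_univ, smul_eq_mul, mul_one]
  rw [← ENNReal.ofReal_add h1 h2, h3, ENNReal.ofReal_one]

/-- The bound for `S = ∑_{i=1}^n G_i`, where `G_1, …, G_n` are independent with the two-point mean
zero law on `{-v²/n, 1}`: they are realised as the coordinates under the product measure. -/
noncomputable def twoPointBound (v : ℝ) (n : ℕ) (x : ℝ) : ℝ :=
  bentkusBound (Measure.pi fun _ : Fin n => twoPoint (v ^ 2 / n)) (fun g => ∑ i, g i) x

/-- The bound for `S = N - v²` with `N` a Poisson variable of mean `v²`. -/
noncomputable def poissonBound (v x : ℝ) : ℝ :=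
  bentkusBound (poissonMeasure (v ^ 2).toNNReal) (fun k : ℕ => (k : ℝ) - v ^ 2) x

/-- `P(N - v² ≥ x)` with `N` a Poisson variable of mean `v²`. -/
noncomputable def poissonTail (v x : ℝ) : ℝ :=
  (poissonMeasure (v ^ 2).toNNReal).real {k : ℕ | x ≤ (k : ℝ) - v ^ 2}

/-- Log-concavity of a nonnegative function on the real line. -/
def IsLogConcave (h : ℝ → ℝ) : Prop :=
  (∀ x, 0 ≤ h x) ∧
    ∀ x y a b : ℝ, 0 < a → 0 < b → a + b = 1 → h x ^ a * h y ^ b ≤ h (a * x + b * y)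

/-- The least log-concave majorant of `f`, as the pointwise infimum of all log-concave
majorants. -/
noncomputable def leastLogConcaveMajorant (f : ℝ → ℝ) (x : ℝ) : ℝ :=
  ⨅ h : {h : ℝ → ℝ // IsLogConcave h ∧ ∀ y, f y ≤ h y}, h.1 x

/-- The pointwise infimum is indeed the least element of the set of log-concave majorants, as soon
as there is one. -/
theorem isLeast_leastLogConcaveMajorant {f : ℝ → ℝ}
    (hne : ∃ h : ℝ → ℝ, IsLogConcave h ∧ ∀ y, f y ≤ h y) :
    IsLeast {h : ℝ → ℝ | IsLogConcave h ∧ ∀ y, f y ≤ h y} (leastLogConcaveMajorant f) := by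
  obtain ⟨h₀, hh₀⟩ := hne
  have : Nonempty {h : ℝ → ℝ // IsLogConcave h ∧ ∀ y, f y ≤ h y} := ⟨⟨h₀, hh₀⟩⟩
  have hbdd : ∀ x, BddBelow (Set.range
      fun h : {h : ℝ → ℝ // IsLogConcave h ∧ ∀ y, f y ≤ h y} => h.1 x) := by
    rintro x
    refine ⟨0, ?_⟩
    rintro _ ⟨h, rfl⟩
    exact h.2.1.1 x
  have hnn : ∀ x, 0 ≤ leastLogConcaveMajorant f x := fun x => le_ciInf fun h => h.2.1.1 x
  have hle : ∀ (h : {h : ℝ → ℝ // IsLogConcave h ∧ ∀ y, f y ≤ h y}) (x : ℝ),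
      leastLogConcaveMajorant f x ≤ h.1 x := fun h x => ciInf_le (hbdd x) h
  refine ⟨⟨⟨hnn, ?_⟩, fun y => le_ciInf fun h => h.2.2 y⟩, fun h hh x => hle ⟨h, hh⟩ x⟩
  intro x y a b ha hb hab
  refine le_ciInf fun h => le_trans ?_ (h.2.1.2 x y a b ha hb hab)
  exact mul_le_mul (Real.rpow_le_rpow (hnn x) (hle h x) ha.le)
    (Real.rpow_le_rpow (hnn y) (hle h y) hb.le) (Real.rpow_nonneg (hnn y) b)
    (Real.rpow_nonneg (h.2.1.1 x) a)

/-- The Poisson tail has a least log-concave majorant. -/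
theorem isLeast_poissonTail (v : ℝ) :
    IsLeast {h : ℝ → ℝ | IsLogConcave h ∧ ∀ y, poissonTail v y ≤ h y}
      (leastLogConcaveMajorant (poissonTail v)) :=
  isLeast_leastLogConcaveMajorant
    ⟨fun _ => 1, ⟨fun _ => zero_le_one, fun _ _ _ _ _ _ _ => by simp⟩,
      fun _ => measureReal_le_one⟩

end Freedman

/-! Fix `t ≥ 0` and let `f u = (1 + (t/2)(u - x))_+²`. This function is nonnegative and at least `1`
on `[x, ∞)`. Stop the sum at the first event, and before any increment that would push the
conditional variance over `v²`. The stopped sum `S_n` is at least `x` on the union of the events, so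
the probability is at most `E f(S_n)`.

What makes `f` work is `IsThirdConvex`: the parabola tangent to `f` at `c` and meeting it again at
`d` lies above `f` to the left of `d` and below it to the right. The class is stable under averaging
over shifts (`step`), and three comparisons follow, each by integrating a parabola whose mean
depends only on the first two moments. (1) An increment `Y ≤ 1` with nonpositive conditional mean
and conditional variance `s` may be replaced by a two-point variable (`le_step_add`). (2) Bringing
two variances together with fixed sum increases the expectation (`step_step_le`), so equal variances
are extremal (`step_iterate_le`). (3) A two-point variable is dominated by the centred Poisson
variable of the same variance (`step_le_poisson`). By (1) and (2), giving the unspent variance in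
equal shares to the remaining two-point steps yields quantities that interpolate monotonically
between `E f(S_n)` and the two-point bound (`integral_posSq_sum_le`). By (3) and additivity of
Poisson laws, the latter is below the Poisson bound. As this does not depend on `n`, continuity from
below handles infinitely many events.

For the constant `e²/2`, a supporting line at `x` of the logarithm of a log-concave majorant `h`
bounds the tail by `h x * exp (-t (u - x))`. With this same `t`, the layer-cake formula gives `e²/2
* h x`. -/

namespace Freedman

/-! ### Two-point averaging and third-order convexity -/

/-- `step s F y = E F(y + G)` for `G` with law `twoPoint s`. -/
noncomputable def step (s : ℝ) (F : ℝ → ℝ) (y : ℝ) : ℝ :=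
  (s * F (y + 1) + F (y - s)) / (1 + s)

/-- The function `F` is nondecreasing and convex with derivative `F'`, and its second order Taylor
quotients at every point are nondecreasing (a weak form of `F''' ≥ 0`). -/
structure IsThirdConvex (F F' : ℝ → ℝ) : Prop where
  deriv_nonneg : ∀ y, 0 ≤ F' y
  tangent_le : ∀ c u, F c + F' c * (u - c) ≤ F u
  quotient_mono : ∀ c u d, u ≤ d → (F u - F c - F' c * (u - c)) * (d - c) ^ 2 ≤
    (F d - F c - F' c * (d - c)) * (u - c) ^ 2

/-- The squared positive part of an affine function. -/
noncomputable def posSq (a b u : ℝ) : ℝ := (max (a + b * u) 0) ^ 2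

/-- The derivative of `posSq a b`. -/
noncomputable def posSqDeriv (a b u : ℝ) : ℝ := 2 * b * max (a + b * u) 0

lemma posSq_taylor_mono (C U D : ℝ) (h : U ≤ D) :
    (max U 0 ^ 2 - max C 0 ^ 2 - 2 * max C 0 * (U - C)) * (D - C) ^ 2 ≤
      (max D 0 ^ 2 - max C 0 ^ 2 - 2 * max C 0 * (D - C)) * (U - C) ^ 2 := by
  rcases le_total 0 C with hC | hC
  · rw [max_eq_left hC]
    rcases le_total 0 U with hU | hU
    · rw [max_eq_left hU, max_eq_left (hU.trans h)]
      apply le_of_eq; ring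
    · rw [max_eq_right hU]
      rcases le_total 0 D with hD | hD
      · rw [max_eq_left hD]
        nlinarith [mul_nonneg (sq_nonneg U) (sq_nonneg (D - C))]
      · rw [max_eq_right hD]
        -- For `U ≤ 0 ≤ C` the Taylor quotient is `1 - (U / (C - U))²`, so the claim reduces to
        -- monotonicity of `(-U) / (C - U)`.
        have h1 : (-D) * (C - U) ≤ (-U) * (C - D) := by nlinarith
        have h2 : ((-D) * (C - U)) ^ 2 ≤ ((-U) * (C - D)) ^ 2 :=
          pow_le_pow_left₀ (mul_nonneg (by linarith) (by linarith)) h1 2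
        nlinarith
  · rw [max_eq_right hC]
    rcases le_total 0 U with hU | hU
    · rw [max_eq_left hU, max_eq_left (hU.trans h)]
      have h1 : U * (D - C) ≤ D * (U - C) := by nlinarith
      have h2 := pow_le_pow_left₀ (mul_nonneg hU (by linarith)) h1 2
      nlinarith
    · rw [max_eq_right hU]
      nlinarith [mul_nonneg (sq_nonneg (max D 0)) (sq_nonneg (U - C))]

lemma posSq_tangent (C U : ℝ) : max C 0 ^ 2 + 2 * max C 0 * (U - C) ≤ max U 0 ^ 2 := by
  rcases le_total 0 C with hC | hC
  · rw [max_eq_left hC]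
    rcases le_total 0 U with hU | hU
    · rw [max_eq_left hU]; nlinarith [sq_nonneg (U - C)]
    · rw [max_eq_right hU]; nlinarith [mul_nonneg hC (neg_nonneg.2 hU)]
  · rw [max_eq_right hC]; nlinarith [sq_nonneg (max U 0)]

lemma isThirdConvex_posSq (a : ℝ) {b : ℝ} (hb : 0 ≤ b) :
    IsThirdConvex (posSq a b) (posSqDeriv a b) where
  deriv_nonneg y := by unfold posSqDeriv; positivity
  tangent_le c u := by
    have := posSq_tangent (a + b * c) (a + b * u)
    unfold posSq posSqDeriv
    linarith
  quotient_mono c u d h := by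
    unfold posSq posSqDeriv
    rcases hb.eq_or_lt with rfl | hb
    · simp
    have h1 := posSq_taylor_mono (a + b * c) (a + b * u) (a + b * d) (by nlinarith)
    have hb2 : 0 < b ^ 2 := by positivity
    refine le_of_mul_le_mul_left ?_ hb2
    linarith

namespace IsThirdConvex

variable {F F' : ℝ → ℝ} {s : ℝ}

/-- The defining inequalities are linear in the pair `(F, F')` and involve only differences of the
arguments, so they survive translations and nonnegative combinations. -/
lemma step (h : IsThirdConvex F F') (hs : 0 ≤ s) :
    IsThirdConvex (step s F) (step s F') where
  deriv_nonneg y := div_nonneg (add_nonneg (mul_nonneg hs (h.deriv_nonneg _)) (h.deriv_nonneg _))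
    (by linarith)
  tangent_le c u := by
    have h1 := mul_le_mul_of_nonneg_left (h.tangent_le (c + 1) (u + 1)) hs
    have h2 := h.tangent_le (c - s) (u - s)
    have hp : 0 < 1 + s := by linarith
    unfold Freedman.step
    rw [div_mul_eq_mul_div, ← add_div, div_le_div_iff_of_pos_right hp]
    linarith
  quotient_mono c u d hud := by
    have h1 := mul_le_mul_of_nonneg_left
      (h.quotient_mono (c + 1) (u + 1) (d + 1) (by linarith)) hs
    have h2 := h.quotient_mono (c - s) (u - s) (d - s) (by linarith)
    have hp : 0 < 1 + s := by linarith
    unfold Freedman.step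
    rw [div_mul_eq_mul_div, div_mul_eq_mul_div, ← sub_div, ← sub_div, ← sub_div, ← sub_div,
      div_mul_eq_mul_div, div_mul_eq_mul_div, div_le_div_iff_of_pos_right hp]
    ring_nf at h1 h2 ⊢
    linarith

lemma iterate (h : IsThirdConvex F F') (hs : 0 ≤ s) (n : ℕ) :
    IsThirdConvex ((Freedman.step s)^[n] F) ((Freedman.step s)^[n] F') := by
  induction n with
  | zero => exact h
  | succ n ih =>
    rw [Function.iterate_succ_apply', Function.iterate_succ_apply']
    exact ih.step hs

lemma mono (h : IsThirdConvex F F') : Monotone F := fun c u hcu => by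
  nlinarith [h.tangent_le c u, mul_nonneg (h.deriv_nonneg c) (sub_nonneg.2 hcu)]

end IsThirdConvex

/-! ### Comparison with a tangent parabola -/

/-- Half the second derivative of the parabola which is tangent to `F` at `y - s` and meets it at
`y + 1`. -/
noncomputable def parabolaCoeff (F F' : ℝ → ℝ) (s y : ℝ) : ℝ :=
  (F (y + 1) - F (y - s) - F' (y - s) * (1 + s)) / (1 + s) ^ 2

lemma IsThirdConvex.parabolaCoeff_nonneg {F F' : ℝ → ℝ} {s : ℝ} (h : IsThirdConvex F F')
    (y : ℝ) : 0 ≤ parabolaCoeff F F' s y := by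
  have := h.tangent_le (y - s) (y + 1)
  exact div_nonneg (by linarith) (by positivity)

/-- Comparison of `F (y + u)`, `u ≤ 1`, with a parabola. -/
lemma IsThirdConvex.le_step_add {F F' : ℝ → ℝ} {s : ℝ} (h : IsThirdConvex F F') (hs : 0 ≤ s)
    (y : ℝ) {u : ℝ} (hu : u ≤ 1) :
    F (y + u) ≤ Freedman.step s F y + (F' (y - s) + 2 * s * parabolaCoeff F F' s y) * u +
      parabolaCoeff F F' s y * (u ^ 2 - s) := by
  have h1 := h.quotient_mono (y - s) (y + u) (y + 1) (by linarith)
  have hp : 0 < 1 + s := by linarith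
  have hp2 : 0 < (1 + s) ^ 2 := by positivity
  set g := parabolaCoeff F F' s y with hg
  have hg' : F (y + 1) = F (y - s) + F' (y - s) * (1 + s) + g * (1 + s) ^ 2 := by
    rw [hg, parabolaCoeff]; field_simp; ring
  have h2 : F (y + u) - F (y - s) - F' (y - s) * (u + s) ≤ g * (u + s) ^ 2 := by
    refine le_of_mul_le_mul_right ?_ hp2
    rw [hg'] at h1
    ring_nf at h1 ⊢
    linarith
  -- The parabola passes through both atoms `y + 1` and `y - s`, so its mean under the two-point law
  -- is `step s F y`. Mean zero and variance `s` then fix its constant term when expanded in `u` and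
  -- `u ^ 2 - s`.
  have h3 : Freedman.step s F y = F (y - s) + F' (y - s) * s + g * (s ^ 2 + s) := by
    rw [Freedman.step, hg']; field_simp; ring
  rw [h3]
  linarith

lemma step_mono_fun {F G : ℝ → ℝ} {s : ℝ} (hs : 0 ≤ s) (h : ∀ y, F y ≤ G y) (y : ℝ) :
    step s F y ≤ step s G y := by
  have h1 := mul_le_mul_of_nonneg_left (h (y + 1)) hs
  have h2 := h (y - s)
  unfold step
  gcongr

/-- Average the parabola built for `t` over the atoms `1` and `-s`: the linear term vanishes, and
the quadratic term is a nonnegative multiple of `s - t ≤ 0`. -/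
lemma IsThirdConvex.step_mono {F F' : ℝ → ℝ} {s t : ℝ} (h : IsThirdConvex F F') (hs : 0 ≤ s)
    (hst : s ≤ t) (y : ℝ) : Freedman.step s F y ≤ Freedman.step t F y := by
  have ht := hs.trans hst
  have h1 := mul_le_mul_of_nonneg_left (h.le_step_add ht y le_rfl) hs
  have h2 := h.le_step_add (u := -s) ht y (by linarith)
  have hg := h.parabolaCoeff_nonneg (s := t) y
  have hp : 0 < 1 + s := by linarith
  rw [Freedman.step, div_le_iff₀ hp, sub_eq_add_neg]
  nlinarith [mul_nonneg (mul_nonneg hg hp.le) (sub_nonneg.2 hst)]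

/-! ### Equal variances are extremal -/

lemma step_step (F : ℝ → ℝ) {a b : ℝ} (ha : 0 ≤ a) (hb : 0 ≤ b) (y : ℝ) :
    step a (step b F) y = (a * b * F (y + 2) + a * F (y + 1 - b) + b * F (y + 1 - a) +
      F (y - (a + b))) / (1 + (a + b) + a * b) := by
  have h1 : y + 1 + 1 = y + 2 := by ring
  have h2 : y - a + 1 = y + 1 - a := by ring
  have h3 : y - a - b = y - (a + b) := by ring
  have : 1 + (a + b) + a * b = (1 + a) * (1 + b) := by ring
  rw [this]
  unfold step
  rw [h1, h2, h3]
  field_simp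
  ring

lemma step_step_comm (F : ℝ → ℝ) {a b : ℝ} (ha : 0 ≤ a) (hb : 0 ≤ b) (y : ℝ) :
    step a (step b F) y = step b (step a F) y := by
  rw [step_step F ha hb, step_step F hb ha]
  congr 1
  · rw [add_comm b a]; ring
  · ring

lemma IsThirdConvex.step_step_le_aux {F F' : ℝ → ℝ} (h : IsThirdConvex F F') {a b c d : ℝ}
    (ha : 0 ≤ a) (hac : a ≤ c) (hcd : c ≤ d) (hs : a + b = c + d) (y : ℝ) :
    Freedman.step a (Freedman.step b F) y ≤ Freedman.step c (Freedman.step d F) y := by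
  -- If `a = d`, all four parameters coincide. Otherwise the tangency point `y + 1 - a` and the
  -- crossing point `y + 1 - d` are distinct.
  rcases (hac.trans hcd).eq_or_lt with rfl | hlt
  · obtain rfl : a = c := le_antisymm hac hcd
    obtain rfl : b = a := by linarith
    exact le_rfl
  have hc : 0 ≤ c := ha.trans hac
  have hd : 0 ≤ d := hc.trans hcd
  have hb : 0 ≤ b := by linarith
  have hdb : d ≤ b := by linarith
  have hprod : a * b ≤ c * d := by
    obtain rfl : b = c + d - a := by linarith
    nlinarith [mul_nonneg (sub_nonneg.2 hac) (sub_nonneg.2 hlt.le)]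
  -- `R` is `F` minus the parabola tangent at `e` and meeting `F` at `y + 1 - d`
  set e := y + 1 - a with he
  set g := (F (y + 1 - d) - F e - F' e * (y + 1 - d - e)) / (y + 1 - d - e) ^ 2 with hg
  have hne : 0 < (y + 1 - d - e) ^ 2 := by
    have : y + 1 - d - e ≠ 0 := by rw [he]; intro h0; linarith
    positivity
  have hgd : F (y + 1 - d) - F e - F' e * (y + 1 - d - e) = g * (y + 1 - d - e) ^ 2 := by
    rw [hg, div_mul_cancel₀ _ hne.ne']
  set R : ℝ → ℝ := fun u => F u - F e - F' e * (u - e) - g * (u - e) ^ 2 with hR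
  have hF : ∀ u, F u = F e + F' e * (u - e) + g * (u - e) ^ 2 + R u := fun u => by
    rw [hR]; ring
  have hRneg : ∀ u, u ≤ y + 1 - d → R u ≤ 0 := fun u hu => by
    have h1 := h.quotient_mono e u _ hu
    rw [hgd, mul_right_comm] at h1
    have := le_of_mul_le_mul_right h1 hne
    rw [hR]; linarith
  have hRpos : ∀ u, y + 1 - d ≤ u → 0 ≤ R u := fun u hu => by
    have h1 := h.quotient_mono e _ u hu
    rw [hgd, mul_right_comm] at h1
    have := le_of_mul_le_mul_right h1 hne
    rw [hR]; linarith
  have hRd : R (y + 1 - d) = 0 := le_antisymm (hRneg _ le_rfl) (hRpos _ le_rfl)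
  -- `K` is the mean of the parabola under both sums, since both have mean zero and variance `a + b
  -- = c + d`. Only `R` distinguishes them, and it vanishes at the atom `y + 1 - a` of the first sum
  -- and at the atom `y + 1 - d` of the second.
  set K := F e + F' e * (y - e) + g * ((y - e) ^ 2 + (a + b)) with hK
  have hpab : 0 < 1 + (a + b) + a * b := by positivity
  have hpcd : 0 < 1 + (a + b) + c * d := by positivity
  have e1 : Freedman.step a (Freedman.step b F) y =
      K + (a * b * R (y + 2) + a * R (y + 1 - b) + R (y - (a + b))) / (1 + (a + b) + a * b) := by
    rw [step_step F ha hb, ← he, div_eq_iff hpab.ne', add_mul, div_mul_cancel₀ _ hpab.ne',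
      hF (y + 2), hF (y + 1 - b), hF (y - (a + b)), hK, he]
    ring
  have e2 : Freedman.step c (Freedman.step d F) y =
      K + (c * d * R (y + 2) + d * R (y + 1 - c) + R (y - (a + b))) / (1 + (a + b) + c * d) := by
    rw [step_step F hc hd, ← hs, div_eq_iff hpcd.ne', add_mul, div_mul_cancel₀ _ hpcd.ne',
      hF (y + 2), hF (y + 1 - c), hF (y - (a + b)), hF (y + 1 - d), hRd, hK]
    obtain rfl : b = c + d - a := by linarith
    ring
  rw [e1, e2]
  have r1 := hRpos (y + 2) (by linarith)
  have r2 := hRneg (y + 1 - b) (by linarith)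
  have r3 := hRneg (y - (a + b)) (by linarith)
  have r4 := hRpos (y + 1 - c) (by linarith)
  have hab0 : 0 ≤ a * b := mul_nonneg ha hb
  have hcd0 : 0 ≤ c * d := mul_nonneg hc hd
  -- After cross-multiplication the difference of the two means of `R` is the sum of these four
  -- terms.
  have q1 : 0 ≤ (c * d - a * b) * R (y + 2) * (1 + (a + b)) := by
    have := sub_nonneg.2 hprod; positivity
  have q2 : 0 ≤ d * R (y + 1 - c) * (1 + (a + b) + a * b) := by positivity
  have q3 : 0 ≤ a * (-R (y + 1 - b)) * (1 + (a + b) + c * d) := by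
    have := neg_nonneg.2 r2; positivity
  have q4 : 0 ≤ (c * d - a * b) * (-R (y - (a + b))) :=
    mul_nonneg (sub_nonneg.2 hprod) (neg_nonneg.2 r3)
  rw [add_le_add_iff_left, div_le_div_iff₀ hpab hpcd]
  linarith

/-- `E F(y + G_a + G_b)` increases when `a` and `b` are brought together with `a + b` fixed. -/
lemma IsThirdConvex.step_step_le {F F' : ℝ → ℝ} (h : IsThirdConvex F F') {a b c d : ℝ}
    (ha : 0 ≤ a) (hb : 0 ≤ b) (hc : 0 ≤ c) (hd : 0 ≤ d) (hs : a + b = c + d)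
    (hp : a * b ≤ c * d) (y : ℝ) :
    Freedman.step a (Freedman.step b F) y ≤ Freedman.step c (Freedman.step d F) y := by
  wlog hab : a ≤ b generalizing a b
  · rw [step_step_comm F ha hb]
    exact this hb ha (by linarith) (by linarith) (by linarith)
  wlog hcd : c ≤ d generalizing c d
  · rw [step_step_comm F hc hd]
    exact this hd hc (by linarith) (by linarith) (by linarith)
  refine h.step_step_le_aux ha ?_ hcd hs y
  -- If `c < a ≤ b` then also `a < d`, and `a * b - c * d = (a - c) * (d - a) > 0`.
  by_contra! hlt
  obtain rfl : b = c + d - a := by linarith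
  nlinarith [mul_pos (sub_pos.2 hlt) (show 0 < d - a by linarith)]

/-- Among sums of `m + 1` independent two-point variables of total variance `(m + 1) c`, the
identically distributed ones give the largest value. -/
lemma IsThirdConvex.step_iterate_le {F F' : ℝ → ℝ} (h : IsThirdConvex F F') (m : ℕ) {a b c : ℝ}
    (ha : 0 ≤ a) (hb : 0 ≤ b) (hc : (m + 1) * c = a + m * b) (y : ℝ) :
    Freedman.step a ((Freedman.step b)^[m] F) y ≤ (Freedman.step c)^[m + 1] F y := by
  induction m generalizing a c y with
  | zero =>
    obtain rfl : c = a := by simpa using hc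
    exact le_rfl
  | succ m ih =>
    push_cast at hc
    have hm : (0 : ℝ) ≤ m := m.cast_nonneg
    have hc0 : 0 ≤ c := by
      have : 0 ≤ (m + 1 + 1 : ℝ) * c := by rw [hc]; positivity
      exact nonneg_of_mul_nonneg_right this (by positivity)
    have hca : (m + 1 + 1) * (c - a) = (m + 1) * (b - a) := by linarith
    have hcb : (m + 1 + 1) * (b - c) = b - a := by linarith
    have hd0 : 0 ≤ a + b - c := by
      have : (m + 1 + 1) * (a + b - c) = (m + 1) * a + b := by linarith
      refine nonneg_of_mul_nonneg_right (this.symm ▸ ?_ : 0 ≤ (m + 1 + 1 : ℝ) * (a + b - c))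
        (by positivity)
      positivity
    -- The average `c` lies between `a` and `b`, and the difference of the two sides is `(c - a) *
    -- (b - c)`. Replacing the pair `(a, b)` by `(c, a + b - c)` settles one variance and leaves the
    -- others with average `c`.
    have hprod : a * b ≤ c * (a + b - c) := by
      have h1 : 0 ≤ ((m + 1 + 1 : ℝ) * (c - a)) * ((m + 1 + 1) * (b - c)) := by
        rw [hca, hcb]
        nlinarith [mul_nonneg hm (sq_nonneg (b - a)), sq_nonneg (b - a)]
      have h2 : 0 ≤ ((m + 1 + 1 : ℝ) ^ 2) * ((c - a) * (b - c)) := by linarith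
      have := nonneg_of_mul_nonneg_right h2 (by positivity)
      linarith
    rw [Function.iterate_succ_apply', Function.iterate_succ_apply' (n := m + 1)]
    refine ((h.iterate hb m).step_step_le ha hb hc0 hd0 (by ring) hprod y).trans ?_
    exact step_mono_fun hc0 (fun z => ih hd0 (by linarith) z) y

/-! ### Bounds, measurability and the product measure -/

lemma step_nonneg {F : ℝ → ℝ} {s : ℝ} (hs : 0 ≤ s) (hF : ∀ y, 0 ≤ F y) (y : ℝ) :
    0 ≤ step s F y :=
  div_nonneg (add_nonneg (mul_nonneg hs (hF _)) (hF _)) (by linarith)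

lemma step_iterate_nonneg {F : ℝ → ℝ} {s : ℝ} (hs : 0 ≤ s) (hF : ∀ y, 0 ≤ F y) (n : ℕ) (y : ℝ) :
    0 ≤ (step s)^[n] F y := by
  induction n generalizing y with
  | zero => exact hF y
  | succ n ih =>
    rw [Function.iterate_succ_apply']
    exact step_nonneg hs ih y

/-- Each two-point variable is at most `1`. This provides the bounds behind integrability. -/
lemma step_iterate_le_of_monotone {F : ℝ → ℝ} {s : ℝ} (hs : 0 ≤ s) (hF : Monotone F) (n : ℕ)
    (y : ℝ) : (step s)^[n] F y ≤ F (y + n) := by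
  induction n generalizing y with
  | zero => simp
  | succ n ih =>
    rw [Function.iterate_succ_apply', step, div_le_iff₀ (by linarith)]
    have h1 := ih (y + 1)
    have h2 := (ih (y - s)).trans (hF (show y - s + n ≤ y + (n + 1 : ℕ) by push_cast; linarith))
    rw [show y + 1 + n = y + (n + 1 : ℕ) by push_cast; ring] at h1
    nlinarith [mul_le_mul_of_nonneg_left h1 hs]

/-- Joint measurability in `(s, y)` is needed because the remaining variance per step is itself
random. -/
lemma measurable_step_iterate {F : ℝ → ℝ} (hF : Measurable F) (n : ℕ) :
    Measurable fun p : ℝ × ℝ => (step p.1)^[n] F p.2 := by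
  induction n with
  | zero => exact hF.comp measurable_snd
  | succ n ih =>
    simp only [Function.iterate_succ_apply', step]
    have h1 : Measurable fun p : ℝ × ℝ => (step p.1)^[n] F (p.2 + 1) :=
      ih.comp (measurable_fst.prodMk (measurable_snd.add_const 1))
    have h2 : Measurable fun p : ℝ × ℝ => (step p.1)^[n] F (p.2 - p.1) :=
      ih.comp (measurable_fst.prodMk (measurable_snd.sub measurable_fst))
    exact ((measurable_fst.mul h1).add h2).div (measurable_fst.const_add 1)

lemma posSq_nonneg (a b u : ℝ) : 0 ≤ posSq a b u := sq_nonneg _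

lemma continuous_posSq (a b : ℝ) : Continuous (posSq a b) := by
  unfold posSq; fun_prop

lemma continuous_posSqDeriv (a b : ℝ) : Continuous (posSqDeriv a b) := by
  unfold posSqDeriv; fun_prop

lemma monotone_posSqDeriv (a : ℝ) {b : ℝ} (hb : 0 ≤ b) : Monotone (posSqDeriv a b) := by
  intro u w h
  unfold posSqDeriv
  gcongr

lemma lintegral_twoPoint {s : ℝ} (g : ℝ → ℝ≥0∞) (hg : Measurable g) :
    ∫⁻ z, g z ∂twoPoint s =
      ENNReal.ofReal (1 / (1 + s)) * g (-s) + ENNReal.ofReal (s / (1 + s)) * g 1 := by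
  rw [twoPoint, lintegral_add_measure, lintegral_smul_measure, lintegral_smul_measure,
    lintegral_dirac' _ hg, lintegral_dirac' _ hg]
  rfl

lemma lintegral_twoPoint_ofReal {s : ℝ} (hs : 0 ≤ s) {F : ℝ → ℝ} (hF : Measurable F)
    (hF0 : ∀ y, 0 ≤ F y) (y : ℝ) :
    ∫⁻ z, ENNReal.ofReal (F (y + z)) ∂twoPoint s = ENNReal.ofReal (step s F y) := by
  have hp : 0 < 1 + s := by linarith
  rw [lintegral_twoPoint _ (by fun_prop), ← ENNReal.ofReal_mul (by positivity),
    ← ENNReal.ofReal_mul (by positivity),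
    ← ENNReal.ofReal_add (mul_nonneg (by positivity) (hF0 _)) (mul_nonneg (by positivity) (hF0 _))]
  congr 1
  rw [step, ← sub_eq_add_neg]
  field_simp
  ring

lemma measurable_iterate_step {F : ℝ → ℝ} (hF : Measurable F) (s : ℝ) (n : ℕ) :
    Measurable ((step s)^[n] F) :=
  (measurable_step_iterate hF n).comp (measurable_const.prodMk measurable_id)

lemma lintegral_pi_twoPoint {s : ℝ} (hs : 0 ≤ s) {F : ℝ → ℝ} (hF : Measurable F)
    (hF0 : ∀ y, 0 ≤ F y) (n : ℕ) (y : ℝ) :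
    ∫⁻ g, ENNReal.ofReal (F (y + ∑ i, g i)) ∂(Measure.pi fun _ : Fin n => twoPoint s) =
      ENNReal.ofReal ((step s)^[n] F y) := by
  have := isProbabilityMeasure_twoPoint hs
  induction n generalizing y with
  | zero => simp
  | succ n ih =>
    have hmp := (measurePreserving_piFinSuccAbove (fun _ : Fin (n + 1) => twoPoint s) 0).symm
    rw [← hmp.lintegral_comp (by fun_prop), lintegral_prod _ (by fun_prop)]
    rw [Function.iterate_succ_apply', ← lintegral_twoPoint_ofReal hs
      (measurable_iterate_step hF s n) (step_iterate_nonneg hs hF0 n)]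
    refine lintegral_congr fun z => ?_
    rw [← ih (y + z)]
    refine lintegral_congr fun g => ?_
    simp [MeasurableEquiv.piFinSuccAbove, Fin.sum_univ_succ, add_assoc]

lemma bentkus_integrand (t x S : ℝ) :
    (max (1 + t / 2 * (S - x)) 0) ^ 2 = posSq (1 - t / 2 * x) (t / 2) S := by
  unfold posSq
  ring_nf

lemma integral_pi_twoPoint {s : ℝ} (hs : 0 ≤ s) (n : ℕ) (a b : ℝ) :
    ∫ g, posSq a b (∑ i, g i) ∂(Measure.pi fun _ : Fin n => twoPoint s) =
      (step s)^[n] (posSq a b) 0 := by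
  have hm := (continuous_posSq a b).measurable
  rw [integral_eq_lintegral_of_nonneg_ae (ae_of_all _ fun _ => posSq_nonneg _ _ _)
    (Measurable.aestronglyMeasurable (by fun_prop))]
  have := lintegral_pi_twoPoint hs hm (posSq_nonneg a b) n 0
  simp only [zero_add] at this
  rw [this, ENNReal.toReal_ofReal (step_iterate_nonneg hs (posSq_nonneg a b) n 0)]

/-! ### Poisson moments and the Poisson comparison -/

/-- The Stein–Chen identity `E[N g(N)] = r E[g(N + 1)]` for Poisson variables. -/
lemma hasSum_poisson_mul {r c : ℝ} {g : ℕ → ℝ}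
    (h : HasSum (fun n : ℕ => Real.exp (-r) * r ^ n / n.factorial * g (n + 1)) c) :
    HasSum (fun n : ℕ => Real.exp (-r) * r ^ n / n.factorial * (n * g n)) (r * c) := by
  rw [← hasSum_nat_add_iff' 1]
  simp only [Finset.range_one, Finset.sum_singleton, Nat.cast_zero, zero_mul, mul_zero, sub_zero]
  convert! h.mul_left r using 2 with n
  rw [Nat.factorial_succ]
  push_cast
  field_simp
  ring

lemma hasSum_poisson_id (r : ℝ≥0) :
    HasSum (fun n : ℕ => Real.exp (-r) * r ^ n / n.factorial * (n : ℝ)) r := by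
  have := hasSum_poisson_mul (r := r) (g := fun _ => 1) (c := 1)
    (by simpa using hasSum_one_poissonMeasure r)
  simpa using this

lemma hasSum_poisson_sq (r : ℝ≥0) :
    HasSum (fun n : ℕ => Real.exp (-r) * r ^ n / n.factorial * (n : ℝ) ^ 2) (r * (r + 1)) := by
  have := hasSum_poisson_mul (r := r) (g := fun n => (n : ℝ)) (c := r + 1) (by
    convert! (hasSum_poisson_id r).add (hasSum_one_poissonMeasure r) using 2 with n
    push_cast; ring)
  simpa [sq] using this

lemma integrable_natCast_poisson (r : ℝ≥0) :
    Integrable (fun n : ℕ => (n : ℝ)) (poissonMeasure r) := by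
  rw [integrable_poissonMeasure_iff]
  simpa using (hasSum_poisson_id r).summable

lemma integrable_natCast_sq_poisson (r : ℝ≥0) :
    Integrable (fun n : ℕ => (n : ℝ) ^ 2) (poissonMeasure r) := by
  rw [integrable_poissonMeasure_iff]
  simpa using (hasSum_poisson_sq r).summable

lemma integral_natCast_poisson (r : ℝ≥0) : ∫ n : ℕ, (n : ℝ) ∂poissonMeasure r = r := by
  simpa [integral_poissonMeasure] using (hasSum_poisson_id r).tsum_eq

lemma integral_natCast_sq_poisson (r : ℝ≥0) :
    ∫ n : ℕ, (n : ℝ) ^ 2 ∂poissonMeasure r = r * (r + 1) := by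
  simpa [integral_poissonMeasure] using (hasSum_poisson_sq r).tsum_eq

lemma integrable_quadratic_poisson (r : ℝ≥0) (α β γ : ℝ) :
    Integrable (fun n : ℕ => α + β * n + γ * (n : ℝ) ^ 2) (poissonMeasure r) :=
  ((integrable_const α).add ((integrable_natCast_poisson r).const_mul β)).add
    ((integrable_natCast_sq_poisson r).const_mul γ)

lemma integral_quadratic_poisson (r : ℝ≥0) (α β γ : ℝ) :
    ∫ n : ℕ, (α + β * n + γ * (n : ℝ) ^ 2) ∂poissonMeasure r =
      α + β * r + γ * (r * (r + 1)) := by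
  have h := integral_add (f := fun n : ℕ => α + β * n) (g := fun n : ℕ => γ * (n : ℝ) ^ 2)
    ((integrable_const α).add ((integrable_natCast_poisson r).const_mul β))
    ((integrable_natCast_sq_poisson r).const_mul γ)
  rw [h, integral_add (integrable_const α) ((integrable_natCast_poisson r).const_mul β),
    integral_const_mul, integral_const_mul, integral_natCast_poisson, integral_natCast_sq_poisson]
  simp

lemma posSq_le (a b u : ℝ) : posSq a b u ≤ (a + b * u) ^ 2 := by
  unfold posSq
  rcases le_total 0 (a + b * u) with h | h
  · rw [max_eq_left h]
  · rw [max_eq_right h]; nlinarith [sq_nonneg (a + b * u)]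

lemma integrable_posSq_poisson (r : ℝ≥0) (a b z : ℝ) :
    Integrable (fun n : ℕ => posSq a b (z + n)) (poissonMeasure r) := by
  refine (integrable_quadratic_poisson r ((a + b * z) ^ 2) (2 * b * (a + b * z)) (b ^ 2)).mono'
    (Measurable.of_discrete.aestronglyMeasurable) (ae_of_all _ fun n => ?_)
  rw [Real.norm_of_nonneg (posSq_nonneg _ _ _)]
  refine (posSq_le a b _).trans (le_of_eq ?_)
  ring

/-- Comparison of a two-point variable with a centred Poisson variable of the same variance. -/
lemma IsThirdConvex.step_le_poisson {F F' : ℝ → ℝ} (h : IsThirdConvex F F') (r : ℝ≥0) (y : ℝ)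
    (hint : Integrable (fun n : ℕ => F (y - r + n)) (poissonMeasure r)) :
    Freedman.step r F y ≤ ∫ n : ℕ, F (y - r + n) ∂poissonMeasure r := by
  rcases eq_or_ne r 0 with rfl | hr
  · refine le_of_eq ?_
    rw [integral_poissonMeasure, tsum_eq_single 0 (fun n hn => by simp [hn])]
    simp [Freedman.step]
  have hr0 : 0 < (r : ℝ) := by exact_mod_cast pos_iff_ne_zero.2 hr
  -- The parabola is tangent at the upper atom `y + 1` and meets `F` at `y + 1 - r`, the Poisson
  -- atom for `n = 1`. Hence `R` is nonnegative at every Poisson atom except the lowest.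
  obtain ⟨g, hg⟩ : ∃ g, F (y + 1 - r) - F (y + 1) - F' (y + 1) * (-r) = g * (r : ℝ) ^ 2 :=
    ⟨_, (div_mul_cancel₀ _ (by positivity)).symm⟩
  set R : ℝ → ℝ := fun u => F u - F (y + 1) - F' (y + 1) * (u - (y + 1)) - g * (u - (y + 1)) ^ 2
    with hR
  have hsub : y + 1 - r - (y + 1) = -r := by ring
  have hRneg : ∀ u, u ≤ y + 1 - r → R u ≤ 0 := fun u hu => by
    have h1 := h.quotient_mono (y + 1) u _ hu
    rw [hsub, hg, neg_sq, mul_right_comm] at h1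
    have := le_of_mul_le_mul_right h1 (by positivity)
    rw [hR]; linarith
  have hRpos : ∀ u, y + 1 - r ≤ u → 0 ≤ R u := fun u hu => by
    have h1 := h.quotient_mono (y + 1) _ u hu
    rw [hsub, hg, neg_sq, mul_right_comm] at h1
    have := le_of_mul_le_mul_right h1 (by positivity)
    rw [hR]; linarith
  set K := F (y + 1) - F' (y + 1) + g * (1 + r) with hK
  have e1 : Freedman.step r F y = K + R (y - r) / (1 + r) := by
    rw [Freedman.step, hR, hK]
    field_simp
    ring
  obtain ⟨α, β, hαβ, hmean⟩ : ∃ α β : ℝ, (∀ n : ℝ, F (y + 1) + F' (y + 1) * (y - r + n - (y + 1)) +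
      g * (y - r + n - (y + 1)) ^ 2 = α + β * n + g * n ^ 2) ∧ α + β * r + g * (r * (r + 1)) = K :=
    ⟨F (y + 1) - F' (y + 1) * (r + 1) + g * (r + 1) ^ 2, F' (y + 1) - 2 * g * (r + 1),
      fun n => by ring, by rw [hK]; ring⟩
  have hRn : ∀ n : ℕ, R (y - r + n) = F (y - r + n) - (α + β * n + g * (n : ℝ) ^ 2) := fun n => by
    rw [← hαβ, hR]; ring
  have hq := integrable_quadratic_poisson r α β g
  have hRint : Integrable (fun n : ℕ => R (y - r + n)) (poissonMeasure r) := by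
    simp_rw [hRn]
    exact hint.sub hq
  have e2 : ∫ n : ℕ, F (y - r + n) ∂poissonMeasure r =
      K + ∫ n : ℕ, R (y - r + n) ∂poissonMeasure r := by
    simp_rw [hRn]
    rw [integral_sub hint hq, integral_quadratic_poisson, hmean]
    ring
  have e3 : Real.exp (-r) * R (y - r) ≤ ∫ n : ℕ, R (y - r + n) ∂poissonMeasure r := by
    have h0 : ∫ n : ℕ, ({0} : Set ℕ).indicator (fun _ => R (y - r)) n ∂poissonMeasure r =
        Real.exp (-r) * R (y - r) := by
      rw [integral_indicator_const _ (measurableSet_singleton 0), poissonMeasure_real_singleton]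
      simp
    rw [← h0]
    refine integral_mono ((integrable_const _).indicator (measurableSet_singleton 0)) hRint
      fun n => ?_
    rcases Nat.eq_zero_or_pos n with rfl | hn
    · simp
    · have : (1 : ℝ) ≤ n := by exact_mod_cast hn
      simpa [Set.indicator, hn.ne'] using hRpos (y - r + n) (by linarith)
  -- The lowest atom `y - r` is common to both laws and `R` is nonpositive there. Its Poisson mass
  -- `exp (-r)` is at most the two-point mass `1 / (1 + r)`.
  have e4 : R (y - r) / (1 + r) ≤ Real.exp (-r) * R (y - r) := by
    rw [div_eq_inv_mul]
    refine mul_le_mul_of_nonpos_right ?_ (hRneg _ (by linarith))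
    rw [Real.exp_neg]
    exact inv_anti₀ (by positivity) (by linarith [Real.add_one_le_exp (r : ℝ)])
  rw [e1, e2]
  linarith

lemma ofReal_step_posSq_le_poisson (r : ℝ≥0) (a : ℝ) {b : ℝ} (hb : 0 ≤ b) (y : ℝ) :
    ENNReal.ofReal (step r (posSq a b) y) ≤
      ∫⁻ n : ℕ, ENNReal.ofReal (posSq a b (y - r + n)) ∂poissonMeasure r := by
  rw [← ofReal_integral_eq_lintegral_ofReal (integrable_posSq_poisson r a b _)
    (ae_of_all _ fun _ => posSq_nonneg _ _ _)]
  exact ENNReal.ofReal_le_ofReal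
    ((isThirdConvex_posSq a hb).step_le_poisson r y (integrable_posSq_poisson r a b _))

/-- The two-point variables are exchanged for Poisson ones one at a time: after swapping the
integrals the new variable is innermost, and Poisson laws convolve by adding their means. -/
lemma ofReal_step_iterate_posSq_le_poisson (r : ℝ≥0) (a : ℝ) {b : ℝ} (hb : 0 ≤ b) (n : ℕ)
    (y : ℝ) : ENNReal.ofReal ((step r)^[n] (posSq a b) y) ≤
      ∫⁻ k : ℕ, ENNReal.ofReal (posSq a b (y - n * r + k)) ∂poissonMeasure (n * r) := by
  have hm := (continuous_posSq a b).measurable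
  have := isProbabilityMeasure_twoPoint r.coe_nonneg
  induction n generalizing y with
  | zero =>
    rw [lintegral_countable' ]
    refine le_trans ?_ (ENNReal.le_tsum 0)
    simp [poissonMeasure_singleton]
  | succ n ih =>
    rw [Function.iterate_succ_apply', ← lintegral_twoPoint_ofReal r.coe_nonneg
      (measurable_iterate_step hm r n) (step_iterate_nonneg r.coe_nonneg (posSq_nonneg a b) n)]
    calc _ ≤ ∫⁻ z, ∫⁻ k : ℕ, ENNReal.ofReal (posSq a b (y + z - n * r + k))
            ∂poissonMeasure (n * r) ∂twoPoint r := lintegral_mono fun z => ih (y + z)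
      _ = ∫⁻ k : ℕ, ∫⁻ z, ENNReal.ofReal (posSq a b (y - n * r + k + z))
            ∂twoPoint r ∂poissonMeasure (n * r) := by
          rw [lintegral_lintegral_swap (by fun_prop)]
          refine lintegral_congr fun k => lintegral_congr fun z => ?_
          congr 2
          ring
      _ = ∫⁻ k : ℕ, ENNReal.ofReal (step r (posSq a b) (y - n * r + k))
            ∂poissonMeasure (n * r) :=
          lintegral_congr fun k => lintegral_twoPoint_ofReal r.coe_nonneg hm (posSq_nonneg a b) _
      _ ≤ ∫⁻ k : ℕ, ∫⁻ j : ℕ, ENNReal.ofReal (posSq a b (y - n * r + k - r + j))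
            ∂poissonMeasure r ∂poissonMeasure (n * r) :=
          lintegral_mono fun k => ofReal_step_posSq_le_poisson r a hb _
      _ = _ := by
          have hadd : ((n + 1 : ℕ) : ℝ≥0) * r = n * r + r := by push_cast; ring
          rw [hadd, ← poissonMeasure_conv_poissonMeasure, Measure.lintegral_conv (by fun_prop)]
          refine lintegral_congr fun k => lintegral_congr fun j => ?_
          congr 2
          push_cast
          ring

lemma step_iterate_posSq_le_integral_poisson {v : ℝ} {n : ℕ} (hn : n ≠ 0) (a : ℝ) {b : ℝ}
    (hb : 0 ≤ b) : (step (v ^ 2 / n))^[n] (posSq a b) 0 ≤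
      ∫ k : ℕ, posSq a b (k - v ^ 2) ∂poissonMeasure (v ^ 2).toNNReal := by
  have hn' : (n : ℝ) ≠ 0 := by exact_mod_cast hn
  obtain ⟨r, hr⟩ : ∃ r : ℝ≥0, (r : ℝ) = v ^ 2 / n :=
    ⟨(v ^ 2 / n).toNNReal, Real.coe_toNNReal _ (by positivity)⟩
  have h2 : (n : ℝ) * r = v ^ 2 := by rw [hr]; field_simp
  have h1 : (n : ℝ≥0) * r = (v ^ 2).toNNReal := by
    ext
    rw [Real.coe_toNNReal _ (sq_nonneg v), NNReal.coe_mul, NNReal.coe_natCast, h2]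
  have h := ofReal_step_iterate_posSq_le_poisson r a hb n 0
  have hint := integrable_posSq_poisson (v ^ 2).toNNReal a b (-v ^ 2)
  rw [h1, h2, zero_sub, hr] at h
  rw [← ofReal_integral_eq_lintegral_ofReal hint (ae_of_all _ fun _ => posSq_nonneg _ _ _),
    ENNReal.ofReal_le_ofReal_iff (integral_nonneg fun _ => posSq_nonneg _ _ _)] at h
  refine h.trans (le_of_eq ?_)
  congr 1
  ext k
  congr 1
  ring

/-- The two-point bound is at most the Poisson bound. -/
theorem twoPointBound_le_poissonBound {v x : ℝ} {n : ℕ} (hn : n ≠ 0) :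
    twoPointBound v n x ≤ poissonBound v x := by
  refine ciInf_mono ⟨0, ?_⟩ fun t => ?_
  · rintro _ ⟨t, rfl⟩
    exact integral_nonneg fun _ => sq_nonneg _
  · simp only [bentkus_integrand]
    rw [integral_pi_twoPoint (by positivity)]
    exact step_iterate_posSq_le_integral_poisson hn _ (by positivity)

/-! ### Log-concave majorants and the constant `e²/2` -/

lemma exists_affine_ge_of_concaveOn {φ : ℝ → ℝ} (hφ : ConcaveOn ℝ Set.univ φ) (x : ℝ) :
    ∃ m, ∀ u, φ u ≤ φ x + m * (u - x) := by
  have hc := hφ.neg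
  have hx : x ∈ interior (Set.univ : Set ℝ) := by simp
  refine ⟨-derivWithin (-φ) (Set.Ioi x) x, fun u => ?_⟩
  rcases lt_trichotomy u x with hu | rfl | hu
  · have h1 := hc.slope_le_leftDeriv_of_mem_interior (Set.mem_univ u) hx hu
    have h2 := hc.leftDeriv_le_rightDeriv_of_mem_interior hx
    have h3 := h1.trans h2
    rw [slope_def_field, div_le_iff₀ (by linarith)] at h3
    simp only [Pi.neg_apply] at h3
    linarith
  · simp
  · have h1 := hc.rightDeriv_le_slope_of_mem_interior hx (Set.mem_univ u) hu
    rw [slope_def_field, le_div_iff₀ (by linarith)] at h1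
    simp only [Pi.neg_apply] at h1
    linarith

lemma IsLogConcave.concaveOn_log {h : ℝ → ℝ} (hh : IsLogConcave h) (hpos : ∀ y, 0 < h y) :
    ConcaveOn ℝ Set.univ fun y => Real.log (h y) := by
  rw [concaveOn_iff_forall_pos]
  refine ⟨convex_univ, fun x _ y _ a b ha hb hab => ?_⟩
  have h1 := Real.log_le_log (mul_pos (Real.rpow_pos_of_pos (hpos x) a)
    (Real.rpow_pos_of_pos (hpos y) b)) (hh.2 x y a b ha hb hab)
  rwa [Real.log_mul (Real.rpow_pos_of_pos (hpos x) a).ne' (Real.rpow_pos_of_pos (hpos y) b).ne',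
    Real.log_rpow (hpos x), Real.log_rpow (hpos y)] at h1

/-- Positivity of the tail makes every majorant positive, so that its logarithm is a real concave
function. -/
lemma poissonTail_pos {v : ℝ} (hv : 0 < v) (y : ℝ) : 0 < poissonTail v y := by
  refine (poissonMeasure_real_singleton_pos ⌈y + v ^ 2⌉₊
    (Real.toNNReal_pos.2 (pow_pos hv 2))).trans_le (measureReal_mono ?_)
  rw [Set.singleton_subset_iff, Set.mem_ofPred_eq]
  linarith [Nat.le_ceil (y + v ^ 2)]

lemma poissonTail_eq_one {v y : ℝ} (hy : y ≤ -v ^ 2) : poissonTail v y = 1 := by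
  have : {k : ℕ | y ≤ (k : ℝ) - v ^ 2} = Set.univ := by
    ext k
    have : (0 : ℝ) ≤ k := k.cast_nonneg
    simp only [Set.mem_ofPred_eq, Set.mem_univ, iff_true]
    linarith
  rw [poissonTail, this, probReal_univ]

lemma bentkusBound_le {α : Type*} {m : MeasurableSpace α} (μ : Measure α) (S : α → ℝ) (x : ℝ)
    (t : ℝ≥0) :
    bentkusBound μ S x ≤ ∫ ω, (max (1 + (t : ℝ) / 2 * (S ω - x)) 0) ^ 2 ∂μ :=
  ciInf_le ⟨0, by rintro _ ⟨t, rfl⟩; exact integral_nonneg fun _ => sq_nonneg _⟩ t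

lemma bentkusBound_le_one {α : Type*} {m : MeasurableSpace α} (μ : Measure α)
    [IsProbabilityMeasure μ] (S : α → ℝ) (x : ℝ) : bentkusBound μ S x ≤ 1 := by
  simpa using bentkusBound_le μ S x 0

lemma integral_mul_exp_neg_two : ∫ s in Set.Ioi (0 : ℝ), s * Real.exp (-(2 * s)) = 1 / 4 := by
  have h := Real.integral_rpow_mul_exp_neg_mul_Ioi (a := 2) (r := 2) (by norm_num) (by norm_num)
  norm_num at h
  exact h

/-- An exponential bound on the tail of `S` bounds `E (1 + (t / 2) (S - x))_+²`. -/
lemma integral_sq_le_of_tail_le {α : Type*} {m : MeasurableSpace α} (μ : Measure α)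
    [IsProbabilityMeasure μ] {S : α → ℝ} (hS : Measurable S) {x t C : ℝ} (ht : 0 < t) (hC : 0 ≤ C)
    (h : ∀ u, μ.real {ω | u ≤ S ω} ≤ C * Real.exp (-t * (u - x))) :
    ∫ ω, (max (1 + t / 2 * (S ω - x)) 0) ^ 2 ∂μ ≤ Real.exp 1 ^ 2 / 2 * C := by
  have hW : Measurable fun ω => max (1 + t / 2 * (S ω - x)) 0 := by fun_prop
  rw [integral_eq_lintegral_of_nonneg_ae (ae_of_all _ fun _ => sq_nonneg _)
    (hW.pow_const 2).aestronglyMeasurable]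
  refine ENNReal.toReal_le_of_le_ofReal (by positivity) ?_
  have hlayer := lintegral_comp_eq_lintegral_meas_le_mul (g := fun s => 2 * s) μ
    (f := fun ω => max (1 + t / 2 * (S ω - x)) 0)
    (ae_of_all _ fun ω => le_max_right _ _) hW.aemeasurable
    (fun s _ => (by fun_prop : Continuous fun s : ℝ => 2 * s).intervalIntegrable _ _)
    (by filter_upwards [ae_restrict_mem measurableSet_Ioi] with s hs
        exact mul_nonneg zero_le_two (le_of_lt hs))
  have hint : ∀ w : ℝ, ∫ s in (0 : ℝ)..w, 2 * s = w ^ 2 := fun w => by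
    rw [intervalIntegral.integral_const_mul, integral_id]; ring
  simp only [hint] at hlayer
  rw [hlayer]
  -- A non-integrable function would have integral `0` by convention, not `1 / 4`.
  have hexp : Integrable (fun s => s * Real.exp (-(2 * s))) (volume.restrict (Set.Ioi (0 : ℝ))) := by
    by_contra hni
    have := integral_mul_exp_neg_two
    rw [integral_undef hni] at this
    norm_num at this
  calc _ ≤ ∫⁻ s in Set.Ioi (0 : ℝ),
        ENNReal.ofReal (2 * C * Real.exp 1 ^ 2 * (s * Real.exp (-(2 * s)))) := by
        refine setLIntegral_mono' measurableSet_Ioi fun s hs => ?_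
        have hs0 : 0 < s := hs
        have hset : {ω | s ≤ max (1 + t / 2 * (S ω - x)) 0} =
            {ω | x + 2 * (s - 1) / t ≤ S ω} := by
          ext ω
          simp only [Set.mem_ofPred_eq, le_max_iff, not_le.2 hs0, or_false]
          rw [← le_sub_iff_add_le', div_le_iff₀ ht]
          constructor <;> intro h <;> linarith
        rw [hset, ← ofReal_measureReal, ← ENNReal.ofReal_mul measureReal_nonneg]
        refine ENNReal.ofReal_le_ofReal ?_
        have h1 := mul_le_mul_of_nonneg_right (h (x + 2 * (s - 1) / t))
          (show 0 ≤ 2 * s by positivity)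
        refine h1.trans (le_of_eq ?_)
        -- The tail at level `s` is thus at most `C * e² * exp (-2s)`, and `2 * C * e² * ∫ s * exp
        -- (-2s) = e² / 2 * C`.
        have h2 : -t * (x + 2 * (s - 1) / t - x) = 1 + 1 + -(2 * s) := by field_simp; ring
        rw [h2, Real.exp_add, Real.exp_add]
        ring
    _ = ENNReal.ofReal (Real.exp 1 ^ 2 / 2 * C) := by
        rw [← ofReal_integral_eq_lintegral_ofReal (hexp.const_mul _), integral_const_mul,
          integral_mul_exp_neg_two]
        · congr 1; ring
        · filter_upwards [ae_restrict_mem measurableSet_Ioi] with s hs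
          have hs0 : 0 < s := hs
          positivity

/-- The slope `m` of a supporting line of `log h` at `x` decides the choice of `t`. For `m < 0` take
`t = -m`. For `m = 0`, `t = 0` suffices since then `h x ≥ 1`. A positive slope is impossible,
because `log h ≥ 0` on `(-∞, -v²]`. -/
theorem poissonBound_le_of_isLogConcave {v : ℝ} (hv : 0 < v) (x : ℝ) {h : ℝ → ℝ}
    (hh : IsLogConcave h) (hle : ∀ y, poissonTail v y ≤ h y) :
    poissonBound v x ≤ Real.exp 1 ^ 2 / 2 * h x := by
  have hpos : ∀ y, 0 < h y := fun y => (poissonTail_pos hv y).trans_le (hle y)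
  obtain ⟨m, hm⟩ := exists_affine_ge_of_concaveOn (hh.concaveOn_log hpos) x
  have hlog : ∀ u, u ≤ -v ^ 2 → 0 ≤ Real.log (h u) := fun u hu =>
    Real.log_nonneg ((poissonTail_eq_one hu).symm.le.trans (hle u))
  rcases lt_trichotomy m 0 with hm0 | rfl | hm0
  · obtain ⟨t, ht⟩ : ∃ t : ℝ≥0, (t : ℝ) = -m := ⟨(-m).toNNReal, Real.coe_toNNReal _ (by linarith)⟩
    refine (bentkusBound_le _ _ x t).trans (integral_sq_le_of_tail_le _ Measurable.of_discrete
      (by linarith) (hpos x).le fun u => (hle u).trans ?_)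
    rw [ht, neg_neg, ← Real.log_le_log_iff (hpos u) (mul_pos (hpos x) (Real.exp_pos _)),
      Real.log_mul (hpos x).ne' (Real.exp_pos _).ne', Real.log_exp]
    exact hm u
  · have h1 : 1 ≤ h x := by
      have h2 := (hlog _ le_rfl).trans (hm (-v ^ 2))
      rw [zero_mul, add_zero] at h2
      exact (Real.log_nonneg_iff (hpos x)).1 h2
    refine (bentkusBound_le_one _ _ x).trans ?_
    have h3 := Real.add_one_le_exp (1 : ℝ)
    nlinarith
  · exfalso
    set u := min (-v ^ 2) (x - (Real.log (h x) + 1) / m) with hu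
    have h1 := (hlog u (min_le_left _ _)).trans (hm u)
    have h2 : u - x ≤ -((Real.log (h x) + 1) / m) := by
      have := min_le_right (-v ^ 2) (x - (Real.log (h x) + 1) / m)
      linarith
    have h3 := mul_le_mul_of_nonneg_left h2 hm0.le
    rw [mul_neg, mul_div_cancel₀ _ hm0.ne'] at h3
    linarith

theorem poissonBound_le_leastLogConcaveMajorant {v : ℝ} (hv : 0 < v) (x : ℝ) :
    poissonBound v x ≤
      Real.exp 1 ^ 2 / 2 * leastLogConcaveMajorant (poissonTail v) x := by
  obtain ⟨hc, hle⟩ := (isLeast_poissonTail v).1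
  exact poissonBound_le_of_isLogConcave hv x hc hle

/-! ### Conditional replacement of one increment -/

section OneStep

variable {Ω : Type*} {m m0 : MeasurableSpace Ω} {μ : Measure Ω}

/-- The pull-out property of the extended conditional expectation. -/
lemma lintegral_mul_condLExp (hm : m ≤ m0) [IsFiniteMeasure μ] {g f : Ω → ℝ≥0∞}
    (hg : Measurable[m] g) (hf : Measurable f) :
    ∫⁻ ω, g ω * condLExp m μ f ω ∂μ = ∫⁻ ω, g ω * f ω ∂μ := by
  have hc := measurable_condLExp' m μ f
  have h : (μ.withDensity (condLExp m μ f)).trim hm = (μ.withDensity f).trim hm := by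
    refine @Measure.ext _ m _ _ fun s hs => ?_
    rw [trim_measurableSet_eq hm hs, trim_measurableSet_eq hm hs, withDensity_apply _ (hm s hs),
      withDensity_apply _ (hm s hs), setLIntegral_condLExp hm μ f hs]
  have h1 := lintegral_withDensity_eq_lintegral_mul μ hc (hg.mono hm le_rfl)
  have h2 := lintegral_withDensity_eq_lintegral_mul μ hf (hg.mono hm le_rfl)
  rw [← lintegral_trim hm hg, h, lintegral_trim hm hg, h2] at h1
  simpa [mul_comm] using h1.symm

lemma integral_mul_nonpos_of_condExp_nonpos (hm : m ≤ m0) [IsFiniteMeasure μ] {X g : Ω → ℝ}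
    (hX : Integrable X μ) (hX0 : μ[X | m] ≤ᵐ[μ] 0) (hg : Measurable[m] g)
    (hg0 : ∀ ω, 0 ≤ g ω) {C : ℝ} (hgC : ∀ᵐ ω ∂μ, g ω ≤ C) : ∫ ω, g ω * X ω ∂μ ≤ 0 := by
  have h := condExp_stronglyMeasurable_mul_of_bound hm hg.stronglyMeasurable hX C
    (by filter_upwards [hgC] with ω h; rwa [Real.norm_of_nonneg (hg0 ω)])
  have h2 : ∫ ω, g ω * X ω ∂μ = ∫ ω, (μ[g * X | m]) ω ∂μ := (integral_condExp hm).symm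
  rw [h2, integral_congr_ae h]
  refine integral_nonpos_of_ae ?_
  filter_upwards [hX0] with ω h
  exact mul_nonpos_of_nonneg_of_nonpos (hg0 ω) h

/-- One step of the comparison: a conditionally centred increment `Y ≤ 1` with conditional variance
`s` at most the remaining budget `w` is replaced by a two-point increment. -/
lemma integral_step_iterate_le (hm : m ≤ m0) [IsProbabilityMeasure μ] (a : ℝ) {b : ℝ} (hb : 0 ≤ b)
    (j : ℕ) {S w s Y : Ω → ℝ} {K V : ℝ} (hS : Measurable[m] S) (hw : Measurable[m] w)
    (hs : Measurable[m] s) (hSK : ∀ᵐ ω ∂μ, S ω ≤ K) (hs0 : ∀ ω, 0 ≤ s ω)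
    (hsw : ∀ ω, s ω ≤ w ω) (hwV : ∀ ω, w ω ≤ V) (hYm : Measurable Y)
    (hY1 : ∀ᵐ ω ∂μ, Y ω ≤ 1) (hYint : Integrable Y μ)
    (hY : ∀ (g : Ω → ℝ) (C : ℝ), Measurable[m] g → (∀ ω, 0 ≤ g ω) → (∀ᵐ ω ∂μ, g ω ≤ C) →
      ∫ ω, g ω * Y ω ∂μ ≤ 0)
    (hY2 : ∀ g : Ω → ℝ≥0∞, Measurable[m] g →
      ∫⁻ ω, g ω * ENNReal.ofReal (Y ω ^ 2) ∂μ = ∫⁻ ω, g ω * ENNReal.ofReal (s ω) ∂μ) :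
    ∫ ω, (step ((w ω - s ω) / j))^[j] (posSq a b) (S ω + Y ω) ∂μ ≤
      ∫ ω, (step (w ω / (j + 1)))^[j + 1] (posSq a b) (S ω) ∂μ := by
  have hf := isThirdConvex_posSq a hb
  have hfm := (continuous_posSq a b).measurable
  have hf'm := (continuous_posSqDeriv a b).measurable
  have hf'mono := monotone_posSqDeriv a hb
  set p : Ω → ℝ := fun ω => (w ω - s ω) / j with hp
  have hp0 : ∀ ω, 0 ≤ p ω := fun ω => div_nonneg (sub_nonneg.2 (hsw ω)) j.cast_nonneg
  have hpm : Measurable[m] p := (hw.sub hs).div_const _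
  have hw0 : ∀ ω, 0 ≤ w ω := fun ω => (hs0 ω).trans (hsw ω)
  have hF : ∀ ω, IsThirdConvex ((step (p ω))^[j] (posSq a b))
    ((step (p ω))^[j] (posSqDeriv a b)) := fun ω => hf.iterate (hp0 ω) j
  -- `γ` and `β` are the random quadratic and linear coefficients of the parabola. They are
  -- `m`-measurable, nonnegative and bounded, so they can serve as test functions in `hY` and `hY2`.
  set γ : Ω → ℝ := fun ω => parabolaCoeff ((step (p ω))^[j] (posSq a b))
    ((step (p ω))^[j] (posSqDeriv a b)) (s ω) (S ω) with hγ
  set β : Ω → ℝ := fun ω => (step (p ω))^[j] (posSqDeriv a b) (S ω - s ω) + 2 * s ω * γ ω with hβ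
  have hγ0 : ∀ ω, 0 ≤ γ ω := fun ω => (hF ω).parabolaCoeff_nonneg _
  have hβ0 : ∀ ω, 0 ≤ β ω := fun ω => add_nonneg ((hF ω).deriv_nonneg _)
    (mul_nonneg (mul_nonneg zero_le_two (hs0 ω)) (hγ0 ω))
  have hHm := measurable_step_iterate hfm j
  have hH'm := measurable_step_iterate hf'm j
  have hγm : Measurable[m] γ := by
    have h1 : Measurable[m] fun ω => (step (p ω))^[j] (posSq a b) (S ω + 1) :=
      hHm.comp (hpm.prodMk (hS.add_const 1))
    have h2 : Measurable[m] fun ω => (step (p ω))^[j] (posSq a b) (S ω - s ω) :=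
      hHm.comp (hpm.prodMk (hS.sub hs))
    have h3 : Measurable[m] fun ω => (step (p ω))^[j] (posSqDeriv a b) (S ω - s ω) :=
      hH'm.comp (hpm.prodMk (hS.sub hs))
    exact ((h1.sub h2).sub (h3.mul (hs.const_add 1))).div ((hs.const_add 1).pow_const 2)
  have hβm : Measurable[m] β :=
    (hH'm.comp (hpm.prodMk (hS.sub hs))).add ((hs.const_mul 2).mul hγm)
  have hγC : ∀ᵐ ω ∂μ, γ ω ≤ posSq a b (K + 1 + j) := by
    filter_upwards [hSK] with ω h
    have h1 := step_iterate_le_of_monotone (hp0 ω) hf.mono j (S ω + 1)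
    have h2 := step_iterate_nonneg (hp0 ω) (posSq_nonneg a b) j (S ω - s ω)
    have h3 := (hF ω).deriv_nonneg (S ω - s ω)
    have h4 := hf.mono (show S ω + 1 + j ≤ K + 1 + j by linarith)
    have h5 := hs0 ω
    refine div_le_of_le_mul₀ (by positivity) (posSq_nonneg _ _ _) ?_
    have h6 : posSq a b (K + 1 + j) * 1 ≤ posSq a b (K + 1 + j) * (1 + s ω) ^ 2 :=
      mul_le_mul_of_nonneg_left (one_le_pow₀ (by linarith)) (posSq_nonneg _ _ _)
    nlinarith [mul_nonneg h3 (show 0 ≤ 1 + s ω by linarith)]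
  have hβC : ∀ᵐ ω ∂μ, β ω ≤ posSqDeriv a b (K + j) + 2 * V * posSq a b (K + 1 + j) := by
    filter_upwards [hSK, hγC] with ω h h'
    have h1 := step_iterate_le_of_monotone (hp0 ω) hf'mono j (S ω - s ω)
    have h5 := hs0 ω
    have h4 := hf'mono (show S ω - s ω + j ≤ K + j by linarith)
    have h6 : s ω ≤ V := (hsw ω).trans (hwV ω)
    have h7 : 2 * s ω * γ ω ≤ 2 * V * posSq a b (K + 1 + j) :=
      mul_le_mul (by linarith) h' (hγ0 ω) (by linarith)
    exact add_le_add (h1.trans h4) h7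
  have bdd : ∀ {g : Ω → ℝ} {C : ℝ}, (∀ ω, 0 ≤ g ω) → (∀ᵐ ω ∂μ, g ω ≤ C) →
      ∀ᵐ ω ∂μ, ‖g ω‖ ≤ C := fun h0 h => by
    filter_upwards [h] with ω h
    rwa [Real.norm_of_nonneg (h0 ω)]
  have hγ' := hγm.mono hm le_rfl
  have hβ' := hβm.mono hm le_rfl
  have hsint : Integrable s μ := Integrable.of_bound (hs.mono hm le_rfl).aestronglyMeasurable V
    (bdd hs0 (ae_of_all _ fun ω => (hsw ω).trans (hwV ω)))
  have hYsq : Integrable (fun ω => Y ω ^ 2) μ := by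
    refine ⟨(hYm.pow_const 2).aestronglyMeasurable, ?_⟩
    rw [hasFiniteIntegral_iff_ofReal (ae_of_all _ fun _ => sq_nonneg _)]
    have := hY2 (fun _ => 1) measurable_const
    simp only [one_mul] at this
    rw [this]
    exact (hasFiniteIntegral_iff_ofReal (ae_of_all _ hs0)).1 hsint.2
  have iβ : Integrable (fun ω => β ω * Y ω) μ :=
    hYint.bdd_mul hβ'.aestronglyMeasurable (bdd hβ0 hβC)
  have iγ : Integrable (fun ω => γ ω * Y ω ^ 2) μ :=
    hYsq.bdd_mul hγ'.aestronglyMeasurable (bdd hγ0 hγC)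
  have iγs : Integrable (fun ω => γ ω * s ω) μ :=
    hsint.bdd_mul hγ'.aestronglyMeasurable (bdd hγ0 hγC)
  have eγ : ∫ ω, γ ω * Y ω ^ 2 ∂μ = ∫ ω, γ ω * s ω ∂μ := by
    rw [integral_eq_lintegral_of_nonneg_ae (ae_of_all _ fun ω => mul_nonneg (hγ0 ω) (sq_nonneg _))
      iγ.1, integral_eq_lintegral_of_nonneg_ae
      (ae_of_all _ fun ω => mul_nonneg (hγ0 ω) (hs0 ω)) iγs.1]
    simp only [ENNReal.ofReal_mul (hγ0 _)]
    rw [hY2 _ hγm.ennreal_ofReal]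
  have iL : Integrable (fun ω => (step (p ω))^[j] (posSq a b) (S ω + Y ω)) μ := by
    refine Integrable.of_bound (hHm.comp ((hpm.mono hm le_rfl).prodMk
      ((hS.mono hm le_rfl).add hYm))).aestronglyMeasurable (posSq a b (K + 1 + j))
      (bdd (fun ω => step_iterate_nonneg (hp0 ω) (posSq_nonneg a b) j _) ?_)
    filter_upwards [hSK, hY1] with ω h h'
    exact (step_iterate_le_of_monotone (hp0 ω) hf.mono j _).trans (hf.mono (by linarith))
  have iR : Integrable (fun ω => (step (w ω / (j + 1)))^[j + 1] (posSq a b) (S ω)) μ := by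
    have hq0 : ∀ ω, 0 ≤ w ω / (j + 1) := fun ω => div_nonneg (hw0 ω) (by positivity)
    refine Integrable.of_bound ((measurable_step_iterate hfm (j + 1)).comp
      (((hw.mono hm le_rfl).div_const _).prodMk (hS.mono hm le_rfl))).aestronglyMeasurable
      (posSq a b (K + (j + 1 : ℕ)))
      (bdd (fun ω => step_iterate_nonneg (hq0 ω) (posSq_nonneg a b) (j + 1) _) ?_)
    filter_upwards [hSK] with ω h
    exact (step_iterate_le_of_monotone (hq0 ω) hf.mono (j + 1) _).trans (hf.mono (by linarith))
  have key : ∀ᵐ ω ∂μ, (step (p ω))^[j] (posSq a b) (S ω + Y ω) ≤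
      (step (w ω / (j + 1)))^[j + 1] (posSq a b) (S ω) + β ω * Y ω +
        (γ ω * Y ω ^ 2 - γ ω * s ω) := by
    filter_upwards [hY1] with ω h
    have h1 := (hF ω).le_step_add (hs0 ω) (S ω) h
    have h2 : step (s ω) ((step (p ω))^[j] (posSq a b)) (S ω) ≤
        (step (w ω / (j + 1)))^[j + 1] (posSq a b) (S ω) := by
      -- With no steps left (`j = 0`) the unspent budget `w - s` cannot be redistributed, and
      -- monotonicity in the variance absorbs it.
      rcases Nat.eq_zero_or_pos j with rfl | hj
      · simpa using hf.step_mono (hs0 ω) (hsw ω) (S ω)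
      · have hj' : (j : ℝ) ≠ 0 := by exact_mod_cast hj.ne'
        refine hf.step_iterate_le j (hs0 ω) (hp0 ω) ?_ _
        rw [hp]
        field_simp
        ring
    rw [mul_sub] at h1
    linarith
  calc _ ≤ ∫ ω, ((step (w ω / (j + 1)))^[j + 1] (posSq a b) (S ω) + β ω * Y ω +
        (γ ω * Y ω ^ 2 - γ ω * s ω)) ∂μ :=
        integral_mono_ae iL ((iR.add iβ).add (iγ.sub iγs)) key
    _ = ∫ ω, (step (w ω / (j + 1)))^[j + 1] (posSq a b) (S ω) ∂μ + ∫ ω, β ω * Y ω ∂μ := by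
        have h1 := integral_add (iR.add iβ) (iγ.sub iγs)
        have h2 := integral_add iR iβ
        have h3 := integral_sub iγ iγs
        simp only [Pi.add_apply, Pi.sub_apply] at h1
        rw [h1, h2, h3, eγ, sub_self, add_zero]
    _ ≤ _ := by linarith [hY β _ hβm hβ0 hβC]

end OneStep

/-! ### Stopping and the maximal inequalities -/

lemma sum_range_add_one_eq_sum_Icc {M : Type*} [AddCommMonoid M] (f : ℕ → M) (k : ℕ) :
    ∑ i ∈ Finset.range k, f (i + 1) = ∑ i ∈ Finset.Icc 1 k, f i := by
  induction k with
  | zero => simp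
  | succ k ih => rw [Finset.sum_range_succ, ih, Finset.sum_Icc_succ_top (by omega)]

section Stopping

variable {Ω : Type*} {m0 : MeasurableSpace Ω} {μ : Measure Ω} {ℱ : Filtration ℕ m0}
  {X : ℕ → Ω → ℝ}

/-- The event, known at time `i`, on which the increment `X (i + 1)` is still counted: the
conditional variance up to time `i + 1` is within the budget, and none of the events occurred so
far. -/
def active (X : ℕ → Ω → ℝ) (ℱ : Filtration ℕ m0) (μ : Measure Ω) (x v : ℝ) (i : ℕ) : Set Ω :=
  {ω | ∑ j ∈ Finset.Icc 1 (i + 1), condSq X ℱ μ j ω ≤ ENNReal.ofReal (v ^ 2)} ∩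
    (⋃ k ∈ Finset.Icc 1 i, event X ℱ μ x v k)ᶜ

lemma measurable_condSq_succ (i : ℕ) : Measurable[ℱ i] (condSq X ℱ μ (i + 1)) :=
  measurable_condLExp (ℱ i) μ _

lemma measurable_condSq {i j : ℕ} (h : i ≤ j + 1) : Measurable[ℱ j] (condSq X ℱ μ i) :=
  (measurable_condLExp (ℱ (i - 1)) μ _).mono (ℱ.mono (by omega)) le_rfl

lemma measurable_sum_condSq {k j : ℕ} (h : k ≤ j + 1) :
    Measurable[ℱ j] fun ω => ∑ i ∈ Finset.Icc 1 k, condSq X ℱ μ i ω :=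
  Finset.measurable_fun_sum _ fun _ hi =>
    measurable_condSq ((Finset.mem_Icc.1 hi).2.trans h)

lemma IsSupermartingaleDifference.measurable (hX : IsSupermartingaleDifference X ℱ μ) {i j : ℕ}
    (h : i ≤ j) : Measurable[ℱ j] (X i) :=
  (hX.adapted i).measurable.mono (ℱ.mono h) le_rfl

lemma IsSupermartingaleDifference.measurableSet_event (hX : IsSupermartingaleDifference X ℱ μ)
    (x v : ℝ) {k j : ℕ} (h : k ≤ j) : MeasurableSet[ℱ j] (event X ℱ μ x v k) := by
  have h1 : Measurable[ℱ j] fun ω => ∑ i ∈ Finset.Icc 1 k, X i ω :=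
    Finset.measurable_fun_sum _ fun i hi => hX.measurable ((Finset.mem_Icc.1 hi).2.trans h)
  have h2 := measurable_sum_condSq (X := X) (μ := μ) (ℱ := ℱ) (h.trans j.le_succ)
  exact (h1 measurableSet_Ici).inter (h2 measurableSet_Iic)

lemma IsSupermartingaleDifference.measurableSet_active (hX : IsSupermartingaleDifference X ℱ μ)
    (x v : ℝ) (i : ℕ) : MeasurableSet[ℱ i] (active X ℱ μ x v i) := by
  have h2 := measurable_sum_condSq (X := X) (μ := μ) (ℱ := ℱ) (le_refl (i + 1))
  refine MeasurableSet.inter (h2 measurableSet_Iic) (MeasurableSet.compl ?_)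
  exact Finset.measurableSet_biUnion _ fun k hk =>
    hX.measurableSet_event x v (Finset.mem_Icc.1 hk).2

/-- The increments that are still counted. -/
noncomputable def stoppedIncrement (X : ℕ → Ω → ℝ) (ℱ : Filtration ℕ m0) (μ : Measure Ω)
    (x v : ℝ) (i : ℕ) : Ω → ℝ :=
  (active X ℱ μ x v i).indicator (X (i + 1))

/-- The conditional variances of the increments that are still counted. -/
noncomputable def stoppedVariance (X : ℕ → Ω → ℝ) (ℱ : Filtration ℕ m0) (μ : Measure Ω)
    (x v : ℝ) (i : ℕ) (ω : Ω) : ℝ :=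
  ((active X ℱ μ x v i).indicator (condSq X ℱ μ (i + 1)) ω).toReal

/-- At the last active index the whole sum of conditional variances is within the budget. The bound
holds at every `ω`, so the stopped variances are finite and real-valued without loss. -/
lemma sum_indicator_condSq_le (x v : ℝ) (k : ℕ) (ω : Ω) :
    ∑ i ∈ Finset.range k, (active X ℱ μ x v i).indicator (condSq X ℱ μ (i + 1)) ω ≤
      ENNReal.ofReal (v ^ 2) := by
  induction k with
  | zero => simp
  | succ k ih =>
    by_cases h : ω ∈ active X ℱ μ x v k
    · refine le_trans ?_ h.1
      rw [← sum_range_add_one_eq_sum_Icc (fun i => condSq X ℱ μ i ω)]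
      exact Finset.sum_le_sum fun i _ => Set.indicator_le_self _ _ ω
    · rw [Finset.sum_range_succ, Set.indicator_of_notMem h, add_zero]
      exact ih

lemma indicator_condSq_ne_top (x v : ℝ) (i : ℕ) (ω : Ω) :
    (active X ℱ μ x v i).indicator (condSq X ℱ μ (i + 1)) ω ≠ ∞ := by
  refine ne_top_of_le_ne_top ENNReal.ofReal_ne_top
    (le_trans ?_ (sum_indicator_condSq_le (X := X) (ℱ := ℱ) (μ := μ) x v (i + 1) ω))
  exact Finset.single_le_sum
    (f := fun i => (active X ℱ μ x v i).indicator (condSq X ℱ μ (i + 1)) ω)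
    (fun _ _ => zero_le) (Finset.self_mem_range_succ i)

lemma sum_stoppedVariance_le (x v : ℝ) (k : ℕ) (ω : Ω) :
    ∑ i ∈ Finset.range k, stoppedVariance X ℱ μ x v i ω ≤ v ^ 2 := by
  unfold stoppedVariance
  rw [← ENNReal.toReal_sum fun i _ => indicator_condSq_ne_top x v i ω]
  exact ENNReal.toReal_le_of_le_ofReal (sq_nonneg v) (sum_indicator_condSq_le x v k ω)

lemma IsSupermartingaleDifference.measurable_stoppedIncrement
    (hX : IsSupermartingaleDifference X ℱ μ) (x v : ℝ) {i j : ℕ} (h : i + 1 ≤ j) :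
    Measurable[ℱ j] (stoppedIncrement X ℱ μ x v i) :=
  (hX.measurable h).indicator (ℱ.mono (i.le_succ.trans h) _ (hX.measurableSet_active x v i))

lemma IsSupermartingaleDifference.measurable_stoppedVariance
    (hX : IsSupermartingaleDifference X ℱ μ) (x v : ℝ) {i j : ℕ} (h : i ≤ j) :
    Measurable[ℱ j] (stoppedVariance X ℱ μ x v i) :=
  (((measurable_condSq_succ i).indicator (hX.measurableSet_active x v i)).ennreal_toReal).mono
    (ℱ.mono h) le_rfl

lemma IsSupermartingaleDifference.lintegral_mul_stoppedIncrement_sq [IsFiniteMeasure μ]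
    (hX : IsSupermartingaleDifference X ℱ μ) (x v : ℝ) (i : ℕ) {g : Ω → ℝ≥0∞}
    (hg : Measurable[ℱ i] g) :
    ∫⁻ ω, g ω * ENNReal.ofReal (stoppedIncrement X ℱ μ x v i ω ^ 2) ∂μ =
      ∫⁻ ω, g ω * ENNReal.ofReal (stoppedVariance X ℱ μ x v i ω) ∂μ := by
  have hA := hX.measurableSet_active x v i
  have hXm : Measurable (X (i + 1)) := (hX.measurable le_rfl).mono (ℱ.le _) le_rfl
  have h := lintegral_mul_condLExp (μ := μ) (ℱ.le i) (hg.indicator hA)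
    (f := fun ω => ENNReal.ofReal (X (i + 1) ω ^ 2)) (by fun_prop)
  refine Eq.trans (lintegral_congr fun ω => ?_) (h.symm.trans (lintegral_congr fun ω => ?_))
  · by_cases hω : ω ∈ active X ℱ μ x v i <;> simp [stoppedIncrement, hω]
  · rw [stoppedVariance, ENNReal.ofReal_toReal (indicator_condSq_ne_top x v i ω)]
    by_cases hω : ω ∈ active X ℱ μ x v i <;> simp [hω, condSq]

lemma IsSupermartingaleDifference.integral_mul_stoppedIncrement_nonpos [IsFiniteMeasure μ]
    (hX : IsSupermartingaleDifference X ℱ μ) (x v : ℝ) (i : ℕ) (g : Ω → ℝ) (C : ℝ)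
    (hg : Measurable[ℱ i] g) (hg0 : ∀ ω, 0 ≤ g ω) (hgC : ∀ᵐ ω ∂μ, g ω ≤ C) :
    ∫ ω, g ω * stoppedIncrement X ℱ μ x v i ω ∂μ ≤ 0 := by
  have hA := hX.measurableSet_active x v i
  have h := integral_mul_nonpos_of_condExp_nonpos (ℱ.le i) (hX.integrable (i + 1))
    (hX.condExp_nonpos i) (hg.indicator hA) (fun ω => Set.indicator_nonneg (fun ω _ => hg0 ω) ω)
    (C := C) (by
      filter_upwards [hgC] with ω h
      exact (Set.indicator_le_self' (fun _ _ => hg0 _) ω).trans h)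
  refine le_of_eq_of_le (integral_congr_ae (ae_of_all _ fun ω => ?_)) h
  by_cases hω : ω ∈ active X ℱ μ x v i <;> simp [stoppedIncrement, hω]

/-- On the union of the events, the stopped sum is at least `x`. -/
lemma le_sum_stoppedIncrement {x v : ℝ} {n : ℕ} {ω : Ω}
    (h : ω ∈ ⋃ k ∈ Finset.Icc 1 n, event X ℱ μ x v k) :
    x ≤ ∑ i ∈ Finset.range n, stoppedIncrement X ℱ μ x v i ω := by
  classical
  simp only [Set.mem_iUnion, Finset.mem_Icc, exists_prop] at h
  -- At the first index `k` whose event occurs, all increments up to `k` are active, since earlier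
  -- variance sums are no larger than the one at `k`. All later increments are switched off.
  obtain ⟨⟨hk1, hkn⟩, hk⟩ := Nat.find_spec h
  have hmin : ∀ j, 1 ≤ j → j < Nat.find h → ω ∉ event X ℱ μ x v j := fun j hj1 hj hjE =>
    Nat.find_min h hj ⟨⟨hj1, hj.le.trans hkn⟩, hjE⟩
  set k := Nat.find h
  rw [← Finset.sum_range_add_sum_Ico _ hkn]
  have h1 : ∑ i ∈ Finset.Ico k n, stoppedIncrement X ℱ μ x v i ω = 0 := by
    refine Finset.sum_eq_zero fun i hi => Set.indicator_of_notMem (fun hact => hact.2 ?_) _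
    simp only [Set.mem_iUnion, Finset.mem_Icc, exists_prop]
    exact ⟨k, ⟨hk1, (Finset.mem_Ico.1 hi).1⟩, hk⟩
  have h2 : ∑ i ∈ Finset.range k, stoppedIncrement X ℱ μ x v i ω =
      ∑ i ∈ Finset.range k, X (i + 1) ω := by
    refine Finset.sum_congr rfl fun i hi => ?_
    have hact : ω ∈ active X ℱ μ x v i := by
      refine ⟨le_trans (Finset.sum_le_sum_of_subset ?_) hk.2, ?_⟩
      · exact Finset.Icc_subset_Icc_right (Finset.mem_range.1 hi)
      · simp only [Set.mem_compl_iff, Set.mem_iUnion, Finset.mem_Icc, exists_prop, not_exists,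
          not_and]
        exact fun j hj => hmin j hj.1 (hj.2.trans_lt (Finset.mem_range.1 hi))
    exact Set.indicator_of_mem hact _
  rw [h1, h2, add_zero]
  refine hk.1.trans (le_of_eq ?_)
  exact (sum_range_add_one_eq_sum_Icc (fun i => X i ω) k).symm

/-- The comparison of the stopped sum with a sum of independent two-point variables. -/
lemma IsSupermartingaleDifference.integral_posSq_sum_le [IsProbabilityMeasure μ]
    (hX : IsSupermartingaleDifference X ℱ μ) (hX1 : ∀ i, ∀ᵐ ω ∂μ, X i ω ≤ 1) (x v : ℝ) (n : ℕ)
    (a : ℝ) {b : ℝ} (hb : 0 ≤ b) :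
    ∫ ω, posSq a b (∑ i ∈ Finset.range n, stoppedIncrement X ℱ μ x v i ω) ∂μ ≤
      (step (v ^ 2 / n))^[n] (posSq a b) 0 := by
  set Y := stoppedIncrement X ℱ μ x v with hYdef
  set τ := stoppedVariance X ℱ μ x v with hτdef
  have hY1 : ∀ i, ∀ᵐ ω ∂μ, Y i ω ≤ 1 := fun i => by
    filter_upwards [hX1 (i + 1)] with ω h
    exact Set.indicator_apply_le' (fun _ => h) fun _ => zero_le_one
  have hS1 : ∀ k : ℕ, ∀ᵐ ω ∂μ, ∑ i ∈ Finset.range k, Y i ω ≤ k := fun k => by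
    filter_upwards [ae_all_iff.2 hY1] with ω h
    simpa using Finset.sum_le_card_nsmul (Finset.range k) (fun i => Y i ω) 1 fun i _ => h i
  have hτ0 : ∀ i ω, 0 ≤ τ i ω := fun i ω => ENNReal.toReal_nonneg
  -- `M k` keeps the first `k` stopped increments and spreads the unspent variance equally over `n -
  -- k` two-point steps. At `k = n` the division by zero is harmless, as `step` is iterated zero
  -- times.
  set M : ℕ → ℝ := fun k => ∫ ω, (step ((v ^ 2 - ∑ i ∈ Finset.range k, τ i ω) /
    (n - k : ℕ)))^[n - k] (posSq a b) (∑ i ∈ Finset.range k, Y i ω) ∂μ with hM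
  have hMstep : ∀ k, k < n → M (k + 1) ≤ M k := fun k hk => by
    obtain ⟨j, hj⟩ : ∃ j, n - k = j + 1 := ⟨n - k - 1, by omega⟩
    have hj' : n - (k + 1) = j := by omega
    have h := integral_step_iterate_le (μ := μ) (ℱ.le k) a hb j
      (S := fun ω => ∑ i ∈ Finset.range k, Y i ω)
      (w := fun ω => v ^ 2 - ∑ i ∈ Finset.range k, τ i ω) (s := τ k) (Y := Y k) (K := k)
      (V := v ^ 2)
      (Finset.measurable_fun_sum _ fun i hi =>
        hX.measurable_stoppedIncrement x v (Finset.mem_range.1 hi))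
      (Measurable.const_sub (Finset.measurable_fun_sum _ fun i hi =>
        hX.measurable_stoppedVariance x v (Finset.mem_range.1 hi).le) _)
      (hX.measurable_stoppedVariance x v le_rfl) (hS1 k) (hτ0 k)
      (fun ω => by
        have := sum_stoppedVariance_le (X := X) (ℱ := ℱ) (μ := μ) x v (k + 1) ω
        rw [Finset.sum_range_succ] at this
        simp only [hτdef]
        linarith)
      (fun ω => by
        have := Finset.sum_nonneg fun i (_ : i ∈ Finset.range k) => hτ0 i ω
        linarith)
      ((hX.measurable_stoppedIncrement x v le_rfl).mono (ℱ.le _) le_rfl) (hY1 k)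
      ((hX.integrable (k + 1)).indicator (ℱ.le k _ (hX.measurableSet_active x v k)))
      (hX.integral_mul_stoppedIncrement_nonpos x v k)
      (fun g hg => hX.lintegral_mul_stoppedIncrement_sq x v k hg)
    simp only [hM, hj, hj', Finset.sum_range_succ, ← sub_sub]
    push_cast
    exact h
  have hMle : ∀ k, k ≤ n → M k ≤ M 0 := fun k => by
    induction k with
    | zero => exact fun _ => le_rfl
    | succ k ih => exact fun hk => (hMstep k hk).trans (ih (Nat.le_of_succ_le hk))
  have h := hMle n le_rfl
  simpa [hM] using h

/-- The maximal inequality for finitely many events. -/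
theorem IsSupermartingaleDifference.measureReal_biUnion_event_le [IsProbabilityMeasure μ]
    (hX : IsSupermartingaleDifference X ℱ μ) (hX1 : ∀ i, ∀ᵐ ω ∂μ, X i ω ≤ 1) (x v : ℝ) (n : ℕ) :
    μ.real (⋃ k ∈ Finset.Icc 1 n, event X ℱ μ x v k) ≤ twoPointBound v n x := by
  refine le_ciInf fun t => ?_
  simp only [bentkus_integrand]
  rw [integral_pi_twoPoint (by positivity)]
  refine le_trans ?_ (hX.integral_posSq_sum_le hX1 x v n _ (by positivity))
  set E := ⋃ k ∈ Finset.Icc 1 n, event X ℱ μ x v k with hE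
  have hEm : MeasurableSet E := Finset.measurableSet_biUnion _ fun k _ =>
    ℱ.le k _ (hX.measurableSet_event x v le_rfl)
  have hSm : Measurable fun ω => ∑ i ∈ Finset.range n, stoppedIncrement X ℱ μ x v i ω :=
    Finset.measurable_fun_sum _ fun i _ =>
      (hX.measurable_stoppedIncrement x v le_rfl).mono (ℱ.le _) le_rfl
  have hmono := (isThirdConvex_posSq (1 - (t : ℝ) / 2 * x) (b := (t : ℝ) / 2) (by positivity)).mono
  have hint : Integrable (fun ω => posSq (1 - (t : ℝ) / 2 * x) (t / 2)
      (∑ i ∈ Finset.range n, stoppedIncrement X ℱ μ x v i ω)) μ := by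
    refine Integrable.of_bound ((continuous_posSq _ _).measurable.comp hSm).aestronglyMeasurable
      (posSq (1 - (t : ℝ) / 2 * x) (t / 2) n) ?_
    filter_upwards [ae_all_iff.2 hX1] with ω h
    rw [Real.norm_of_nonneg (posSq_nonneg _ _ _)]
    refine hmono ?_
    simpa using Finset.sum_le_card_nsmul (Finset.range n)
      (fun i => stoppedIncrement X ℱ μ x v i ω) 1 fun i _ =>
        Set.indicator_apply_le' (fun _ => h (i + 1)) fun _ => zero_le_one
  have hone : μ.real E = ∫ ω, E.indicator (fun _ => (1 : ℝ)) ω ∂μ := by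
    rw [integral_indicator_const _ hEm]; simp
  rw [hone]
  refine integral_mono ((integrable_const _).indicator hEm) hint fun ω => ?_
  refine Set.indicator_apply_le' (fun hω => ?_) fun _ => posSq_nonneg _ _ _
  refine le_trans (le_of_eq ?_) (hmono (le_sum_stoppedIncrement hω))
  unfold posSq
  simp

/-- The maximal inequality for all the events. -/
theorem IsSupermartingaleDifference.measureReal_iUnion_event_le [IsProbabilityMeasure μ]
    (hX : IsSupermartingaleDifference X ℱ μ) (hX1 : ∀ i, ∀ᵐ ω ∂μ, X i ω ≤ 1) (x v : ℝ) :
    μ.real (⋃ k ∈ Set.Ici 1, event X ℱ μ x v k) ≤ poissonBound v x := by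
  -- The index is shifted to `n + 1` because the Poisson comparison requires a nonzero number of
  -- steps.
  have hunion : ⋃ k ∈ Set.Ici 1, event X ℱ μ x v k =
      ⋃ n, ⋃ k ∈ Finset.Icc 1 (n + 1), event X ℱ μ x v k := by
    ext ω
    simp only [Set.mem_iUnion, Set.mem_Ici, Finset.mem_Icc, exists_prop]
    exact ⟨fun ⟨k, h1, h⟩ => ⟨k, k, ⟨h1, k.le_succ⟩, h⟩, fun ⟨_, k, h1, h⟩ => ⟨k, h1.1, h⟩⟩
  have hmono : Monotone fun n => ⋃ k ∈ Finset.Icc 1 (n + 1), event X ℱ μ x v k := fun n n' h =>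
    Set.biUnion_subset_biUnion_left (Finset.Icc_subset_Icc_right (Nat.succ_le_succ h))
  rw [hunion]
  have ht := (ENNReal.tendsto_toReal (measure_ne_top μ _)).comp
    (tendsto_measure_iUnion_atTop (μ := μ) hmono)
  exact le_of_tendsto' ht fun n => (hX.measureReal_biUnion_event_le hX1 x v (n + 1)).trans
    (twoPointBound_le_poissonBound n.succ_ne_zero)

end Stopping

end Freedman

theorem mainTheorem1 {Ω : Type*} {m0 : MeasurableSpace Ω} (μ : Measure Ω) [IsProbabilityMeasure μ]
    (ℱ : Filtration ℕ m0) (X : ℕ → Ω → ℝ)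
    (hX : Freedman.IsSupermartingaleDifference X ℱ μ)
    (hX0 : X 0 =ᵐ[μ] 0)
    (hX1 : ∀ i, ∀ᵐ ω ∂μ, X i ω ≤ 1)
    (x v : ℝ) (hv : 0 < v) :
    (∀ n : ℕ, 1 ≤ n →
      μ.real (⋃ k ∈ Finset.Icc 1 n, Freedman.event X ℱ μ x v k) ≤ Freedman.twoPointBound v n x ∧
      Freedman.twoPointBound v n x ≤ Freedman.poissonBound v x) ∧
    μ.real (⋃ k ∈ Set.Ici 1, Freedman.event X ℱ μ x v k) ≤ Freedman.poissonBound v x ∧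
    Freedman.poissonBound v x ≤
      Real.exp 1 ^ 2 / 2 * Freedman.leastLogConcaveMajorant (Freedman.poissonTail v) x :=
  ⟨fun n hn => ⟨hX.measureReal_biUnion_event_le hX1 x v n,
    Freedman.twoPointBound_le_poissonBound (Nat.one_le_iff_ne_zero.1 hn)⟩,
    hX.measureReal_iUnion_event_le hX1 x v, Freedman.poissonBound_le_leastLogConcaveMajorant hv x⟩
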